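/- **Definitions.** A hypergraph $g$ over a ranked alphabet consists of a finite nonempty set $V$ of nodes, a finite set $E$ of edges, for every edge $e$ a label $\mathrm{lab}(e)$ and a nonempty repetition-free string $\mathrm{att}(e)$ of nodes whose length is the rank of $\mathrm{lab}(e)$ (the rank of $e$), and a repetition-free string $\mathrm{ext}$ of external nodes, whose length is the rank of $g$. Its size $|g|$ is $|V|$ plus the number of edges of rank at most $2$ plus the sum of the ranks of all edges of rank greater than $2$. A hyperedge replacement grammar $G=(N,P,S)$ over a ranked alphabet $\Sigma$ of terminals has a finite ranked set $N$ of nonterminals, disjoint from $\Sigma$, finitely many rules $(A,g)\in P$ with $A\in N$ and $g$ a hypergraph over $\Sigma\cup N$ of rank $\mathrm{rank}(A)$, and a start graph $S$ over $\Sigma\cup N$. A derivation step replaces an edge $e$ labelled by a nonterminal $A$ by a fresh copy of a right-hand side $g$ of $A$, identifying the $i$-th external node of $g$ with the $i$-th node attached to $e$. The grammar is straight-line (an SL-HR grammar) if the relation "$B$ occurs in a right-hand side of $A$" on $N$ is acyclic, every $A\in N$ has exactly one rule $(A,\mathrm{rhs}(A))$, and every nonterminal occurs in some graph derivable from $S$.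 Then all terminal hypergraphs derivable from $S$ are isomorphic, and $\mathrm{val}(G)$ denotes one of them. The size $|G|$ is the sum of the sizes of all right-hand sides, the start graph included. A hypergraph is a *tree-graph* if it is, up to isomorphism, obtained as follows from a finite ordered ranked tree, some of whose leaves may be marked as parameters, and which is not just a single parameter. Its nodes are the nodes of the tree; every node $u$ that is not a parameter and has children $u_1,\dots,u_k$ ($k\ge 0$) contributes exactly one edge, which is attached to $u\,u_1\cdots u_k$ and is labelled by the symbol at $u$ (of rank $k+1$ as an edge label); there are no other edges; the first external node is the root, and the remaining external nodes are exactly the parameters, in some order. (A tree-graph of rank $1$ is the usual hypergraph encoding of an ordered ranked tree.) **Theorem.** Let $G=(N,P,S)$ be an SL-HR grammar such that $\mathrm{val}(G)$ is a tree-graph. Then there is an SL-HR grammar $G'=(N',P',S')$ over the same terminals such that 1. $\mathrm{val}(G')$ is isomorphic to $\mathrm{val}(G)$ (including labels, the order of attached nodes, and external nodes), 2. $|G'|\le 2|G|$, and 3. the start graph $S'$ and $\mathrm{rhs}_{G'}(A)$, for every $A\in N'$, are tree-graphs. -/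

import Mathlib

universe u

/-- A hypergraph over the ranked alphabet `(X, rk)`: a finite nonempty set of nodes, a finite set of
edges, each attached to a nonempty repetition-free string of nodes whose length is the rank of the
edge label, and a repetition-free string of external nodes. -/
structure HGraph {X : Type u} (rk : X → ℕ) where
  V : Type
  E : Type
  [fintypeV : Fintype V]
  [nonemptyV : Nonempty V]
  [fintypeE : Fintype E]
  att : E → List V
  lab : E → X
  ext : List V
  att_ne : ∀ e, att e ≠ []
  att_nodup : ∀ e, (att e).Nodup
  att_rank : ∀ e, (att e).length = rk (lab e)
  ext_nodup : ext.Nodup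

namespace HGraph

attribute [instance] HGraph.fintypeV HGraph.nonemptyV HGraph.fintypeE

variable {X : Type u} {rk : X → ℕ}

/-- The rank of a hypergraph: the number of its external nodes. -/
def rank (g : HGraph rk) : ℕ := g.ext.length

/-- Edges of rank at most two have size one, edges of larger rank have size equal to the rank. -/
def edgeSize (g : HGraph rk) : ℕ :=
  ∑ e, if (g.att e).length ≤ 2 then 1 else (g.att e).length

/-- The size `|g| = |g|_V + |g|_E`. -/
def size (g : HGraph rk) : ℕ := Fintype.card g.V + g.edgeSize

/-- Two hypergraphs are isomorphic if they differ only in the names of nodes and edges. -/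
def Isomorphic (g h : HGraph rk) : Prop :=
  ∃ (f : g.V ≃ h.V) (k : g.E ≃ h.E),
    (∀ e, h.att (k e) = (g.att e).map f) ∧ (∀ e, h.lab (k e) = g.lab e) ∧ h.ext = g.ext.map f

/-- Change of alphabet along a rank-preserving map. -/
def relabel {Y : Type u} {rk' : Y → ℕ} (φ : X → Y) (hφ : ∀ x, rk' (φ x) = rk x)
    (g : HGraph rk) : HGraph rk' where
  V := g.V
  E := g.E
  att := g.att
  lab e := φ (g.lab e)
  ext := g.ext
  att_ne := g.att_ne
  att_nodup := g.att_nodup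
  att_rank e := by rw [hφ, g.att_rank]
  ext_nodup := g.ext_nodup

open Classical in
/-- The node of `g[e/h]` coming from a node `v` of `h`: the `i`-th external node of `h` is
identified with the `i`-th node attached to `e`, an internal node of `h` becomes a fresh node. -/
noncomputable def glue (g h : HGraph rk) (e : g.E) (hr : (g.att e).length = h.rank) (v : h.V) :
    g.V ⊕ {v : h.V // v ∉ h.ext} :=
  if hv : v ∈ h.ext then
    Sum.inl ((g.att e)[h.ext.idxOf v]'(hr ▸ List.idxOf_lt_length_of_mem hv))
  else Sum.inr ⟨v, hv⟩

theorem glue_injective (g h : HGraph rk) (e : g.E) (hr : (g.att e).length = h.rank) :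
    Function.Injective (g.glue h e hr) := by
  classical
  intro v w hvw
  unfold glue at hvw
  by_cases hv : v ∈ h.ext <;> by_cases hw : w ∈ h.ext
  · simp only [hv, hw, dite_true, Sum.inl.injEq] at hvw
    have := (g.att_nodup e).getElem_inj_iff.1 hvw
    exact (List.idxOf_inj hv).1 this
  · simp [hv, hw] at hvw
  · simp [hv, hw] at hvw
  · simpa [hv, hw] using hvw

open Classical in
/-- The replacement `g[e/h]` of the edge `e` of `g` by the hypergraph `h`: remove `e`, add a copy
of `h` whose internal nodes are fresh and whose external nodes are the nodes attached to `e`. -/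
noncomputable def replace (g : HGraph rk) (e : g.E) (h : HGraph rk)
    (hr : (g.att e).length = h.rank) : HGraph rk where
  V := g.V ⊕ {v : h.V // v ∉ h.ext}
  E := {e' : g.E // e' ≠ e} ⊕ h.E
  att := Sum.elim (fun e' => (g.att e').map Sum.inl) (fun e' => (h.att e').map (g.glue h e hr))
  lab := Sum.elim (fun e' => g.lab e') h.lab
  ext := g.ext.map Sum.inl
  att_ne := by
    rintro (e' | e')
    · simpa using g.att_ne e'
    · simpa using h.att_ne e'
  att_nodup := by
    rintro (e' | e')
    · exact (g.att_nodup e').map Sum.inl_injective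
    · exact (h.att_nodup e').map (glue_injective g h e hr)
  att_rank := by
    rintro (e' | e')
    · simpa using g.att_rank e'
    · simpa using h.att_rank e'
  ext_nodup := g.ext_nodup.map Sum.inl_injective

/-- `g` is (up to isomorphism) the graph of an ordered ranked tree whose non-first external nodes
are leaf parameters. `addr` assigns to every node its Dewey address in the tree. The first external
node is the root. A node `u` of the tree carrying a symbol with `k` children is the first node of
exactly one edge; this edge is labelled by the symbol and attached to `u · u1 ⋯ uk`. The external
nodes other than the root are leaves, and they carry no symbol. If the root is the only external
node, this is the usual encoding of a tree as a hypergraph. -/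
def IsTreeGraph (g : HGraph rk) : Prop :=
  ∃ (addr : g.V → List ℕ) (root : g.V) (params : List g.V),
    Function.Injective addr ∧
    g.ext = root :: params ∧
    addr root = [] ∧
    (∀ e, ∃ u ws, g.att e = u :: ws ∧
      ∀ (i : ℕ) (hi : i < ws.length), addr ws[i] = addr u ++ [i + 1]) ∧
    (∀ v, v ≠ root → ∃ e, v ∈ (g.att e).tail) ∧
    (∀ v, v ∉ params → ∃! e, (g.att e).head? = some v) ∧
    (∀ v, v ∈ params → ∀ e, (g.att e).head? ≠ some v)

end HGraph

/-- A hyperedge replacement grammar over the ranked alphabet `(T, rk)` of terminals: a finite ranked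
set `N` of nonterminals (disjoint from the terminals), a finite family `P` of rules, where the rule
`p` has left-hand side `lhs p` and right-hand side `rhs p`, and a start graph. -/
structure HRGrammar {T : Type u} (rk : T → ℕ) where
  N : Type
  [fintypeN : Fintype N]
  nrk : N → ℕ
  P : Type
  [fintypeP : Fintype P]
  lhs : P → N
  rhs : P → HGraph (Sum.elim rk nrk)
  rank_rhs : ∀ p, (rhs p).rank = nrk (lhs p)
  start : HGraph (Sum.elim rk nrk)

namespace HRGrammar

attribute [instance] HRGrammar.fintypeN HRGrammar.fintypeP

variable {T : Type u} {rk : T → ℕ}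

/-- Hypergraphs over terminals and nonterminals of `G`. -/
abbrev Graph (G : HRGrammar rk) := HGraph (Sum.elim rk G.nrk)

/-- The size of a grammar: the sum of the sizes of all right-hand sides, the start graph included. -/
def size (G : HRGrammar rk) : ℕ := G.start.size + ∑ p, (G.rhs p).size

theorem length_att (G : HRGrammar rk) (g : G.Graph) (e : g.E) (p : G.P)
    (h : g.lab e = Sum.inr (G.lhs p)) : (g.att e).length = (G.rhs p).rank := by
  rw [g.att_rank, h, G.rank_rhs]; rfl

/-- One derivation step: a nonterminal edge is replaced by a right-hand side for its label. -/
inductive Step (G : HRGrammar rk) : G.Graph → G.Graph → Prop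
  | mk (g : G.Graph) (e : g.E) (p : G.P) (h : g.lab e = Sum.inr (G.lhs p)) :
      Step G g (g.replace e (G.rhs p) (G.length_att g e p h))

/-- Derivation in any finite number of steps. -/
def Derives (G : HRGrammar rk) : G.Graph → G.Graph → Prop := Relation.ReflTransGen G.Step

/-- The language of `G`: all hypergraphs over the terminals that can be derived from the start
graph, where node and edge names do not matter. -/
def language (G : HRGrammar rk) : Set (HGraph rk) :=
  {g | ∃ g' : G.Graph, G.Derives G.start g' ∧
    g'.Isomorphic (g.relabel (rk' := Sum.elim rk G.nrk) (Y := T ⊕ G.N) Sum.inl fun _ => rfl)}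

/-- `G.Calls A B`: the nonterminal `B` occurs in a right-hand side for `A`. -/
def Calls (G : HRGrammar rk) (A B : G.N) : Prop :=
  ∃ p, G.lhs p = A ∧ ∃ e, (G.rhs p).lab e = Sum.inr B

/-- A straight-line grammar: the nonterminals call each other acyclically, every nonterminal has
exactly one rule, and every nonterminal occurs in some graph derivable from the start graph. -/
structure IsStraightLine (G : HRGrammar rk) : Prop where
  acyclic : ∀ A, ¬ Relation.TransGen G.Calls A A
  existsUnique_rule : ∀ A, ∃! p, G.lhs p = A
  useful : ∀ A, ∃ g, G.Derives G.start g ∧ ∃ e, g.lab e = Sum.inr A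

theorem IsStraightLine.wellFounded {G : HRGrammar rk} (hG : G.IsStraightLine) :
    WellFounded (fun B A => G.Calls A B) := by
  have h : WellFounded (fun B A => Relation.TransGen G.Calls A B) := by
    have : Std.Irrefl (fun B A => Relation.TransGen G.Calls A B) := ⟨fun A => hG.acyclic A⟩
    have : IsTrans G.N (fun B A => Relation.TransGen G.Calls A B) :=
      ⟨fun _ _ _ h1 h2 => h2.trans h1⟩
    exact Finite.wellFounded_of_trans_of_irrefl _
  exact Subrelation.wf (fun h' => Relation.TransGen.single h') h

open Classical in
/-- A straight-line grammar derives at least one terminal hypergraph. -/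
theorem IsStraightLine.language_nonempty {G : HRGrammar rk} (hG : G.IsStraightLine) :
    G.language.Nonempty := by
  choose r hr using fun A => (hG.existsUnique_rule A).exists
  -- `w A` is one plus the sum of the weights of the nonterminal edges of the right-hand side
  obtain ⟨w, hw⟩ : ∃ w : G.N → ℕ,
      ∀ A, ∑ e, Sum.elim (fun _ => 0) w ((G.rhs (r A)).lab e) < w A := by
    refine ⟨hG.wellFounded.fix fun A rec => 1 + ∑ e, (match h : (G.rhs (r A)).lab e with
      | Sum.inl _ => 0
      | Sum.inr B => rec B ⟨r A, hr A, e, h⟩), fun A => ?_⟩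
    conv_rhs => rw [WellFounded.fix_eq]
    rw [add_comm, Nat.lt_succ_iff]
    refine Finset.sum_le_sum fun e _ => ?_
    split <;> rename_i h <;> simp [h]
  have key : ∀ (n : ℕ) (g : G.Graph), G.Derives G.start g →
      ∑ e, Sum.elim (fun _ => 0) w (g.lab e) ≤ n →
      ∃ g' : G.Graph, G.Derives G.start g' ∧ ∀ e, ∃ t, g'.lab e = Sum.inl t := by
    intro n
    induction n with
    | zero =>
      intro g hg hn
      refine ⟨g, hg, fun e => ?_⟩
      have h0 := (Finset.sum_eq_zero_iff.1 (Nat.le_zero.1 hn)) e (Finset.mem_univ e)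
      rcases h : g.lab e with t | A
      · exact ⟨t, rfl⟩
      · rw [h] at h0
        have := hw A
        simp at h0
        omega
    | succ n ih =>
      intro g hg hn
      by_cases hT : ∀ e, ∃ t, g.lab e = Sum.inl t
      · exact ⟨g, hg, hT⟩
      push Not at hT
      obtain ⟨e, he⟩ := hT
      obtain ⟨A, hA⟩ : ∃ A, g.lab e = Sum.inr A := by
        rcases h : g.lab e with t | A
        · exact absurd h (he t)
        · exact ⟨A, rfl⟩
      have hA' : g.lab e = Sum.inr (G.lhs (r A)) := by rw [hr, hA]
      refine ih _ (hg.tail (Step.mk g e (r A) hA')) ?_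
      have h1 : ∑ x : {e' : g.E // e' ≠ e} ⊕ (G.rhs (r A)).E, Sum.elim (fun _ => 0) w
          (Sum.elim (fun e' : {e' : g.E // e' ≠ e} => g.lab e') (G.rhs (r A)).lab x) ≤ n := by
        rw [Fintype.sum_sum_type]
        have h2 := hw A
        have h3 := Fintype.sum_eq_add_sum_subtype_ne
          (fun e => Sum.elim (fun _ => 0) w (g.lab e)) e
        simp only [Sum.elim_inl, Sum.elim_inr]
        simp only [hA, Sum.elim_inr] at h3
        omega
      exact (Fintype.sum_equiv (Equiv.refl _) _ _ fun _ => rfl).trans_le h1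
  obtain ⟨g, hg, hT⟩ := key _ G.start Relation.ReflTransGen.refl le_rfl
  choose t ht using hT
  refine ⟨{ V := g.V, E := g.E, att := g.att, lab := t, ext := g.ext, att_ne := g.att_ne,
            att_nodup := g.att_nodup, att_rank := fun e => ?_, ext_nodup := g.ext_nodup },
          g, hg, Equiv.refl _, Equiv.refl _, ?_, ?_, ?_⟩
  · rw [g.att_rank, ht]; rfl
  · exact fun e => (List.map_id _).symm
  · exact fun e => (ht e).symm
  · exact (List.map_id _).symm

/-- The hypergraph `val(G)` generated by a straight-line grammar `G`: a member of the language of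
`G`, which contains only one hypergraph up to isomorphism. -/
noncomputable def val (G : HRGrammar rk) (hG : G.IsStraightLine) : HGraph rk :=
  hG.language_nonempty.some

end HRGrammar

/-!
Let `t = val(G)`, a tree. Everything takes place inside `t`. A nonterminal `A` of `G` generates
parts of `t`: a part has a set `F` of edges, a set `I` of internal nodes all of whose edges in `t`
belong to `F`, and a list `l` of external nodes (`HRGrammar.Occ`, `HGraph.IsPart`). Since `t` is a
tree, such a part is a forest. Going up from an edge of the part through internal nodes
(`HGraph.Climb`) leads to a unique external node, and so the part splits into components, each of
which is a tree-graph whose root is an external node and whose leaves are external nodes or leaves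
of `t`.

The new grammar (`HRGrammar.treeGrammar`) has as nonterminals the pairs of a nonterminal `A` and the
position of an external node that is the root of a component. A right-hand side of it is one
component of a right-hand side `g` of `G`, in which every edge `e` has been replaced by its own
components (`HRGrammar.piece`). Which positions are roots (`HRGrammar.Opening`) and which positions
lie below which root (`HRGrammar.Link`) depends only on the label: two parts that are generated by
the same sentential form can be rewritten simultaneously until the form is terminal and embeds into
both (`HRGrammar.Cover.exists_common_terminal`). The same lemma shows that `val` is unique up to
isomorphism (`HRGrammar.Cover.isomorphic`).

A right-hand side of the new grammar is a tree-graph (`HRGrammar.isTreeGraph_piece`), because first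
climbing within the part of an edge of `g` and then within the part of `g` is the same as climbing
in one go. By induction the new grammar generates the components of every part
(`HRGrammar.Occ.componentsOcc`), in particular `t`, which has just one component.

For the size, every node of `g` belongs to at most two components of `g`, once as a root or
internal node and once as a leaf. Likewise the components of an edge of rank `n` have at most `n`
roots and at most `n` leaves altogether, so that their ranks add up to at most `2 * n`
(`HRGrammar.sum_size_piece_le`).
-/

/-! ### Tree-graphs and climbing -/

namespace HGraph

variable {X : Type u} {rk : X → ℕ}

/-- The first node of an edge; in a tree-graph the edge hangs below this node. -/
def top (g : HGraph rk) (e : g.E) : g.V := (g.att e).head (g.att_ne e)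

theorem att_eq_top_cons (g : HGraph rk) (e : g.E) : g.att e = g.top e :: (g.att e).tail :=
  (List.cons_head_tail (g.att_ne e)).symm

theorem head?_att (g : HGraph rk) (e : g.E) : (g.att e).head? = some (g.top e) :=
  List.head?_eq_some_head (g.att_ne e)

theorem top_mem_att (g : HGraph rk) (e : g.E) : g.top e ∈ g.att e := List.head_mem _

/-- Tree-graphs without addresses: every node except the root is a child in exactly one edge, every
node that is not a parameter is the first node of exactly one edge, and a depth function rules out
cycles. -/
structure IsTreeWith (g : HGraph rk) (root : g.V) (params : List g.V) (depth : g.V → ℕ) :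
    Prop where
  ext_eq : g.ext = root :: params
  exists_parent : ∀ v, v ≠ root → ∃ e, v ∈ (g.att e).tail
  parent_unique : ∀ v e e', v ∈ (g.att e).tail → v ∈ (g.att e').tail → e = e'
  root_notMem_tail : ∀ e, root ∉ (g.att e).tail
  exists_top : ∀ v, v ∉ params → ∃ e, g.top e = v
  top_inj : ∀ e e', g.top e = g.top e' → e = e'
  top_notMem_params : ∀ e, g.top e ∉ params
  depth_lt : ∀ e v, v ∈ (g.att e).tail → depth (g.top e) < depth v

theorem IsTreeGraph.exists_isTreeWith {g : HGraph rk} (hg : g.IsTreeGraph) :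
    ∃ root params depth, g.IsTreeWith root params depth := by
  obtain ⟨addr, root, params, hinj, hext, hroot, hedge, hpar, htop, hparams⟩ := hg
  have hchild : ∀ e v, v ∈ (g.att e).tail → ∃ i, addr v = addr (g.top e) ++ [i + 1] ∧
      (g.att e).tail[i]? = some v := by
    intro e v hv
    obtain ⟨u, ws, hatt, hws⟩ := hedge e
    have ht : g.top e = u := by simp [top, hatt]
    rw [hatt, List.tail_cons] at hv ⊢
    obtain ⟨i, hi, rfl⟩ := List.getElem_of_mem hv
    exact ⟨i, by rw [ht]; exact hws i hi, by simp [hi]⟩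
  have hnp : ∀ e, g.top e ∉ params := fun e he => hparams _ he e (g.head?_att e)
  have htinj : ∀ e e', g.top e = g.top e' → e = e' := fun e e' h =>
    (htop _ (hnp e)).unique (g.head?_att e) (by rw [g.head?_att, h])
  refine ⟨root, params, fun v => (addr v).length, hext, hpar, ?_, ?_, ?_, htinj, hnp, ?_⟩
  · intro v e e' h h'
    obtain ⟨i, hi, -⟩ := hchild e v h
    obtain ⟨j, hj, -⟩ := hchild e' v h'
    refine htinj _ _ (hinj ?_)
    rw [hi] at hj
    exact (List.append_inj' hj rfl).1
  · intro e h
    obtain ⟨i, hi, -⟩ := hchild e root h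
    simp [hroot] at hi
  · intro v hv
    obtain ⟨e, he, -⟩ := htop v hv
    exact ⟨e, by simpa [g.head?_att] using he⟩
  · intro e v hv
    obtain ⟨i, hi, -⟩ := hchild e v hv
    simp [hi]

namespace IsTreeWith

variable {g : HGraph rk} {root : g.V} {params : List g.V} {depth : g.V → ℕ}

open Classical in
/-- The Dewey address of a node, computed by going up to the root. -/
noncomputable def addr (hg : g.IsTreeWith root params depth) (v : g.V) : List ℕ :=
  if h : ∃ e, v ∈ (g.att e).tail then
    hg.addr (g.top h.choose) ++ [(g.att h.choose).tail.idxOf v + 1]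
  else []
termination_by depth v
decreasing_by exact hg.depth_lt _ _ h.choose_spec

open Classical in
theorem addr_of_mem_tail (hg : g.IsTreeWith root params depth) {v : g.V} {e : g.E}
    (he : v ∈ (g.att e).tail) :
    hg.addr v = hg.addr (g.top e) ++ [(g.att e).tail.idxOf v + 1] := by
  have h : ∃ e, v ∈ (g.att e).tail := ⟨e, he⟩
  have := hg.parent_unique v _ _ h.choose_spec he
  rw [addr, dif_pos h, this]

theorem addr_root (hg : g.IsTreeWith root params depth) : hg.addr root = [] := by
  rw [addr, dif_neg]
  rintro ⟨e, he⟩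
  exact hg.root_notMem_tail e he

theorem addr_injective (hg : g.IsTreeWith root params depth) : Function.Injective hg.addr := by
  classical
  intro v
  induction hn : depth v using Nat.strong_induction_on generalizing v with
  | _ n ih =>
    subst hn
    intro w hvw
    by_cases hv : v = root
    · by_cases hw : w = root
      · rw [hv, hw]
      · obtain ⟨e, he⟩ := hg.exists_parent w hw
        rw [hv, hg.addr_root, hg.addr_of_mem_tail he] at hvw
        simp at hvw
    · obtain ⟨e, he⟩ := hg.exists_parent v hv
      by_cases hw : w = root
      · rw [hw, hg.addr_root, hg.addr_of_mem_tail he] at hvw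
        simp at hvw
      · obtain ⟨e', he'⟩ := hg.exists_parent w hw
        rw [hg.addr_of_mem_tail he, hg.addr_of_mem_tail he'] at hvw
        obtain ⟨h1, h2⟩ := List.append_inj' hvw rfl
        have := hg.top_inj _ _ (ih _ (hg.depth_lt e v he) rfl h1)
        subst this
        simp only [List.cons.injEq, Nat.add_right_cancel_iff, and_true] at h2
        exact (List.idxOf_inj he).1 h2

theorem isTreeGraph (hg : g.IsTreeWith root params depth) : g.IsTreeGraph := by
  classical
  refine ⟨hg.addr, root, params, hg.addr_injective, hg.ext_eq, hg.addr_root, ?_,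
    hg.exists_parent, ?_, ?_⟩
  · intro e
    refine ⟨g.top e, _, g.att_eq_top_cons e, fun i hi => ?_⟩
    rw [hg.addr_of_mem_tail (List.getElem_mem hi),
      (List.Nodup.tail (g.att_nodup e)).idxOf_getElem]
  · intro v hv
    obtain ⟨e, rfl⟩ := hg.exists_top v hv
    refine ⟨e, g.head?_att e, fun e' he' => hg.top_inj _ _ ?_⟩
    simpa [g.head?_att] using he'
  · intro v hv e he
    rw [g.head?_att, Option.some.injEq] at he
    exact hg.top_notMem_params e (he ▸ hv)

end IsTreeWith

/-- `g.Climb I v w`: going up from `v` from child to parent as long as the current node lies in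
`I` ends in `w`. -/
inductive Climb (g : HGraph rk) (I : Set g.V) : g.V → g.V → Prop
  | refl {v : g.V} : v ∉ I → Climb g I v v
  | up {v w : g.V} {e : g.E} :
      v ∈ I → v ∈ (g.att e).tail → Climb g I (g.top e) w → Climb g I v w

namespace Climb

variable {g : HGraph rk} {I J : Set g.V} {v w w' : g.V}

theorem notMem (h : g.Climb I v w) : w ∉ I := by
  induction h with
  | refl h => exact h
  | up _ _ _ ih => exact ih

theorem eq_of_notMem (h : g.Climb I v w) (hv : v ∉ I) : v = w := by
  cases h with
  | refl => rfl
  | up h => exact absurd h hv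

/-- Climbing further through a larger set. -/
theorem trans (hJI : J ⊆ I) (h : g.Climb J v w) (h' : g.Climb I w w') : g.Climb I v w' := by
  induction h with
  | refl => exact h'
  | up h1 h2 _ ih => exact up (hJI h1) h2 (ih h')

end Climb

namespace IsTreeWith

variable {g : HGraph rk} {root : g.V} {params : List g.V} {depth : g.V → ℕ}
  {I J : Set g.V} {v w w' : g.V}

theorem climb_unique (hg : g.IsTreeWith root params depth) (h : g.Climb I v w)
    (h' : g.Climb I v w') : w = w' := by
  induction h with
  | refl h => exact h'.eq_of_notMem h
  | up h1 h2 _ ih =>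
    cases h' with
    | refl h => exact absurd h1 h
    | up _ h3 h4 =>
      rw [hg.parent_unique _ _ _ h3 h2] at h4
      exact ih h4

theorem exists_climb (hg : g.IsTreeWith root params depth) (hI : root ∉ I) (v : g.V) :
    ∃ w, g.Climb I v w := by
  induction hn : depth v using Nat.strong_induction_on generalizing v with
  | _ n ih =>
    subst hn
    by_cases hv : v ∈ I
    · obtain ⟨e, he⟩ := hg.exists_parent v (fun h => hI (h ▸ hv))
      obtain ⟨w, hw⟩ := ih _ (hg.depth_lt e v he) _ rfl
      exact ⟨w, .up hv he hw⟩
    · exact ⟨v, .refl hv⟩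

theorem depth_le_of_climb (hg : g.IsTreeWith root params depth) (h : g.Climb I v w) :
    depth w ≤ depth v := by
  induction h with
  | refl => exact le_rfl
  | up _ h2 _ ih => exact ih.trans (hg.depth_lt _ _ h2).le

/-- Climbing through a larger set passes the point where climbing through the smaller one stops. -/
theorem climb_of_climb_subset (hg : g.IsTreeWith root params depth) (hJI : J ⊆ I)
    (h : g.Climb J v w) (h' : g.Climb I v w') : g.Climb I w w' := by
  induction h with
  | refl => exact h'
  | up h1 h2 _ ih =>
    cases h' with
    | refl h => exact absurd (hJI h1) h
    | up _ h3 h4 =>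
      rw [hg.parent_unique _ _ _ h3 h2] at h4
      exact ih h4

end IsTreeWith

end HGraph

/-! ### Parts of a terminal hypergraph generated by a sentential form -/

namespace HRGrammar

variable {T : Type u} {rk : T → ℕ}

/-- The node map `α` places the hypergraph `g` inside the terminal hypergraph `t`, where the edge
`e` of `g` stands for the edges in `Fe e` and the fresh nodes in `Ie e`; the whole has the edges
`F`, the internal nodes `I` and the external nodes `l`. -/
structure Splits {Y : Type u} {rk' : Y → ℕ} (g : HGraph rk') (t : HGraph rk) (α : g.V → t.V)
    (Fe : g.E → Set t.E) (Ie : g.E → Set t.V) (F : Set t.E) (I : Set t.V) (l : List t.V) :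
    Prop where
  inj : Function.Injective α
  mem_edges : ∀ f, f ∈ F ↔ ∃ e, f ∈ Fe e
  mem_nodes : ∀ v, v ∈ I ↔ (∃ u, u ∉ g.ext ∧ α u = v) ∨ ∃ e, v ∈ Ie e
  ext_eq : l = g.ext.map α
  edges_disj : ∀ e e' f, f ∈ Fe e → f ∈ Fe e' → e = e'
  nodes_disj : ∀ e e' v, v ∈ Ie e → v ∈ Ie e' → e = e'
  map_notMem : ∀ e u, α u ∉ Ie e

/-- `G.Occ t x F I l`: the part of the terminal hypergraph `t` with edges `F`, internal nodes `I`
and external nodes `l` is generated by an edge with label `x`. -/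
inductive Occ (G : HRGrammar rk) (t : HGraph rk) :
    T ⊕ G.N → Set t.E → Set t.V → List t.V → Prop
  | terminal (f : t.E) : Occ G t (Sum.inl (t.lab f)) {f} ∅ (t.att f)
  | rule (p : G.P) (α : (G.rhs p).V → t.V) (Fe : (G.rhs p).E → Set t.E)
      (Ie : (G.rhs p).E → Set t.V) (F : Set t.E) (I : Set t.V) (l : List t.V)
      (hs : Splits (G.rhs p) t α Fe Ie F I l)
      (ho : ∀ e, Occ G t ((G.rhs p).lab e) (Fe e) (Ie e) (((G.rhs p).att e).map α)) :
      Occ G t (Sum.inr (G.lhs p)) F I l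

/-- The part `(F, I, l)` of `t` is generated by the sentential form `g`, placed in `t` by `α`. -/
structure Cover (G : HRGrammar rk) (t : HGraph rk) (g : G.Graph) (α : g.V → t.V)
    (Fe : g.E → Set t.E) (Ie : g.E → Set t.V) (F : Set t.E) (I : Set t.V) (l : List t.V) :
    Prop extends Splits g t α Fe Ie F I l where
  occ : ∀ e, G.Occ t (g.lab e) (Fe e) (Ie e) ((g.att e).map α)

variable {G : HRGrammar rk} {t : HGraph rk} {F : Set t.E} {I : Set t.V} {l : List t.V}

theorem Occ.exists_terminal {x : T ⊕ G.N} (h : G.Occ t x F I l) {a : T} (hx : x = Sum.inl a) :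
    ∃ f, t.lab f = a ∧ F = {f} ∧ I = ∅ ∧ l = t.att f := by
  cases h with
  | terminal f => exact ⟨f, Sum.inl_injective hx, rfl, rfl, rfl⟩
  | rule => simp at hx

theorem Occ.exists_cover {x : T ⊕ G.N} (h : G.Occ t x F I l) {A : G.N} (hx : x = Sum.inr A) :
    ∃ p, G.lhs p = A ∧ ∃ α Fe Ie, G.Cover t (G.rhs p) α Fe Ie F I l := by
  cases h with
  | terminal f => simp at hx
  | rule p α Fe Ie _ _ _ hs ho => exact ⟨p, Sum.inr_injective hx, α, Fe, Ie, ⟨hs, ho⟩⟩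

theorem Cover.occ_rule {p : G.P} {α Fe Ie} (h : G.Cover t (G.rhs p) α Fe Ie F I l) :
    G.Occ t (Sum.inr (G.lhs p)) F I l :=
  .rule p α Fe Ie F I l h.toSplits h.occ

/-- The edges of an occurrence are attached to its own nodes only. -/
theorem Occ.mem_of_mem_att {x : T ⊕ G.N} (h : G.Occ t x F I l) {f : t.E} (hf : f ∈ F) {v : t.V}
    (hv : v ∈ t.att f) : v ∈ I ∨ v ∈ l := by
  induction h with
  | terminal f' =>
    rw [Set.mem_singleton_iff] at hf
    subst hf
    exact Or.inr hv
  | rule p α Fe Ie F I l hs ho ih =>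
    obtain ⟨e, he⟩ := (hs.mem_edges f).1 hf
    rcases ih e he with h | h
    · exact Or.inl ((hs.mem_nodes v).2 (Or.inr ⟨e, h⟩))
    · obtain ⟨u, -, rfl⟩ := List.mem_map.1 h
      by_cases hu : u ∈ (G.rhs p).ext
      · rw [hs.ext_eq]
        exact Or.inr (List.mem_map_of_mem hu)
      · exact Or.inl ((hs.mem_nodes _).2 (Or.inl ⟨u, hu, rfl⟩))

/-- A node map on `g` and one on `h` that agree on the nodes identified by gluing combine to a map
on the replacement that extends the latter. -/
theorem map_glue {Y : Type u} {rk' : Y → ℕ} {g h : HGraph rk'} {e : g.E}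
    {hr : (g.att e).length = h.rank} {W : Type*} {α : g.V → W} {β : h.V → W}
    (hαβ : (g.att e).map α = h.ext.map β) (v : h.V) :
    Sum.elim α (fun v : {v : h.V // v ∉ h.ext} => β v) (g.glue h e hr v) = β v := by
  classical
  unfold HGraph.glue
  split_ifs with hv
  · have h1 : h.ext.idxOf v < h.ext.length := List.idxOf_lt_length_of_mem hv
    have h2 : h.ext.idxOf v < (g.att e).length := hr ▸ h1
    have h3 : ((g.att e).map α)[h.ext.idxOf v]'(by simpa using h2) =
        (h.ext.map β)[h.ext.idxOf v]'(by simpa using h1) := by simp only [hαβ]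
    simp only [List.getElem_map, List.getElem_idxOf] at h3
    rw [Sum.elim_inl]
    convert h3
  · rfl

theorem map_att_glue {Y : Type u} {rk' : Y → ℕ} (g h : HGraph rk') (e : g.E)
    (hr : (g.att e).length = h.rank) : h.ext.map (g.glue h e hr) = (g.att e).map Sum.inl := by
  classical
  apply List.ext_getElem
  · simpa [HGraph.rank] using hr.symm
  · intro i h1 h2
    simp only [List.length_map] at h1 h2
    have hm : h.ext[i] ∈ h.ext := List.getElem_mem h1
    simp only [List.getElem_map, HGraph.glue, hm, dite_true, h.ext_nodup.idxOf_getElem]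

/-- A derivation step at the edge `e` refines a cover. -/
theorem Cover.expand {g : G.Graph} {α Fe Ie} (hc : G.Cover t g α Fe Ie F I l) (e : g.E)
    (p : G.P) (hp : ∀ q, G.lhs q = G.lhs p → q = p) (he : g.lab e = Sum.inr (G.lhs p)) :
    ∃ α' Fe' Ie', G.Cover t (g.replace e (G.rhs p) (G.length_att g e p he)) α' Fe' Ie' F I l ∧
      ∀ v, α' (Sum.inl v) = α v := by
  classical
  obtain ⟨q, hq, β, Fh, Ih, hh⟩ := (hc.occ e).exists_cover he
  obtain rfl := hp q hq
  have hg := map_glue (hr := G.length_att g e q he) hh.ext_eq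
  -- an internal node of the right-hand side lies among the fresh nodes of `e`
  have hint : ∀ v, v ∉ (G.rhs q).ext → β v ∈ Ie e := fun v hv =>
    (hh.mem_nodes _).2 (Or.inl ⟨v, hv, rfl⟩)
  have hsubI : ∀ e' v, v ∈ Ih e' → v ∈ Ie e := fun e' v hv =>
    (hh.mem_nodes _).2 (Or.inr ⟨e', hv⟩)
  have hsubF : ∀ e' f, f ∈ Fh e' → f ∈ Fe e := fun e' v hv => (hh.mem_edges _).2 ⟨e', hv⟩
  refine ⟨Sum.elim α (fun v => β v), Sum.elim (fun e' => Fe e') Fh,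
    Sum.elim (fun e' => Ie e') Ih, ⟨⟨?_, ?_, ?_, ?_, ?_, ?_, ?_⟩, ?_⟩, fun v => rfl⟩
  · rintro (v | v) (w | w) hvw
    · exact congrArg Sum.inl (hc.inj hvw)
    · exact absurd (hint w w.2) (by rw [← show α v = β w from hvw]; exact hc.map_notMem e v)
    · exact absurd (hint v v.2) (by rw [show β v = α w from hvw]; exact hc.map_notMem e w)
    · exact congrArg Sum.inr (Subtype.ext (hh.inj hvw))
  · intro f
    rw [hc.mem_edges]
    constructor
    · rintro ⟨e', hf⟩
      by_cases h : e' = e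
      · subst h
        obtain ⟨e'', h''⟩ := (hh.mem_edges f).1 hf
        exact ⟨Sum.inr e'', h''⟩
      · exact ⟨Sum.inl ⟨e', h⟩, hf⟩
    · rintro ⟨e' | e', hf⟩
      · exact ⟨e', hf⟩
      · exact ⟨e, hsubF _ _ hf⟩
  · intro v
    rw [hc.mem_nodes]
    constructor
    · rintro (⟨u, hu, rfl⟩ | ⟨e', hv⟩)
      · refine Or.inl ⟨Sum.inl u, fun h => hu ?_, rfl⟩
        obtain ⟨w, hw, h⟩ := List.mem_map.1 h
        exact Sum.inl_injective h ▸ hw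
      · by_cases h : e' = e
        · subst h
          rcases (hh.mem_nodes v).1 hv with ⟨u, hu, rfl⟩ | ⟨e'', h''⟩
          · refine Or.inl ⟨Sum.inr ⟨u, hu⟩, fun h => ?_, rfl⟩
            obtain ⟨w, hw, h⟩ := List.mem_map.1 h
            simp at h
          · exact Or.inr ⟨Sum.inr e'', h''⟩
        · exact Or.inr ⟨Sum.inl ⟨e', h⟩, hv⟩
    · rintro (⟨u | u, hu, rfl⟩ | ⟨e' | e', hv⟩)
      · exact Or.inl ⟨u, fun h => hu (List.mem_map_of_mem h), rfl⟩
      · exact Or.inr ⟨e, hint _ u.2⟩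
      · exact Or.inr ⟨e', hv⟩
      · exact Or.inr ⟨e, hsubI _ _ hv⟩
  · rw [hc.ext_eq]
    exact (List.map_map (l := g.ext) (f := (Sum.inl : g.V → g.V ⊕ {v // v ∉ (G.rhs q).ext}))
      (g := Sum.elim α (fun v : {v // v ∉ (G.rhs q).ext} => β v))).symm
  · rintro (e1 | e1) (e2 | e2) f h1 h2
    · exact congrArg Sum.inl (Subtype.ext (hc.edges_disj _ _ f h1 h2))
    · exact absurd (hc.edges_disj _ _ f h1 (hsubF _ _ h2)) e1.2
    · exact absurd (hc.edges_disj _ _ f h2 (hsubF _ _ h1)) e2.2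
    · exact congrArg Sum.inr (hh.edges_disj _ _ f h1 h2)
  · rintro (e1 | e1) (e2 | e2) f h1 h2
    · exact congrArg Sum.inl (Subtype.ext (hc.nodes_disj _ _ f h1 h2))
    · exact absurd (hc.nodes_disj _ _ f h1 (hsubI _ _ h2)) e1.2
    · exact absurd (hc.nodes_disj _ _ f h2 (hsubI _ _ h1)) e2.2
    · exact congrArg Sum.inr (hh.nodes_disj _ _ f h1 h2)
  · rintro (e1 | e1) (v | v) h
    · exact hc.map_notMem _ _ h
    · exact e1.2 (hc.nodes_disj _ _ _ h (hint v v.2))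
    · exact hc.map_notMem _ _ (hsubI _ _ h)
    · exact hh.map_notMem _ _ h
  · rintro (e1 | e1)
    · have := hc.occ e1
      show G.Occ t (g.lab e1) _ _ (((g.att e1).map Sum.inl).map _)
      rw [List.map_map]
      exact this
    · have := hh.occ e1
      show G.Occ t ((G.rhs q).lab e1) (Fh e1) (Ih e1)
        ((((G.rhs q).att e1).map (g.glue _ e _)).map
          (Sum.elim α (fun v : {v // v ∉ (G.rhs q).ext} => β v)))
      rw [List.map_map, show Sum.elim α (fun v : {v // v ∉ (G.rhs q).ext} => β v) ∘
        g.glue (G.rhs q) e (G.length_att g e q he) = β from funext hg]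
      exact this

/-- A cover of the result of a derivation step comes from a cover of the hypergraph before it. -/
theorem Cover.unexpand {g : G.Graph} {e : g.E} {p : G.P} {he : g.lab e = Sum.inr (G.lhs p)}
    {α' Fe' Ie'}
    (hc : G.Cover t (g.replace e (G.rhs p) (G.length_att g e p he)) α' Fe' Ie' F I l) :
    ∃ α Fe Ie, G.Cover t g α Fe Ie F I l := by
  classical
  let a : g.V ⊕ {v : (G.rhs p).V // v ∉ (G.rhs p).ext} → t.V := α'
  set gl := g.glue (G.rhs p) e (G.length_att g e p he) with hgl
  have hext := map_att_glue g (G.rhs p) e (G.length_att g e p he)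
  have hglint : ∀ u (hu : u ∉ (G.rhs p).ext), gl u = Sum.inr ⟨u, hu⟩ := fun u hu => by
    rw [hgl, HGraph.glue, dif_neg hu]
  -- the part of `t` that is generated by `e`
  let Fh : Set t.E := {f | ∃ e', f ∈ Fe' (Sum.inr e')}
  let Ih : Set t.V := {v | (∃ u, u ∉ (G.rhs p).ext ∧ a (gl u) = v) ∨ ∃ e', v ∈ Ie' (Sum.inr e')}
  have hh : G.Cover t (G.rhs p) (fun v => a (gl v)) (fun e' => Fe' (Sum.inr e'))
      (fun e' => Ie' (Sum.inr e')) Fh Ih ((g.att e).map fun v => a (Sum.inl v)) := by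
    refine ⟨⟨?_, fun f => Iff.rfl, fun v => Iff.rfl, ?_, ?_, ?_, ?_⟩, ?_⟩
    · exact hc.inj.comp (HGraph.glue_injective _ _ _ _)
    · have := congrArg (List.map a) hext
      rw [List.map_map, List.map_map] at this
      exact this.symm
    · exact fun e1 e2 f h1 h2 => Sum.inr_injective (hc.edges_disj _ _ f h1 h2)
    · exact fun e1 e2 f h1 h2 => Sum.inr_injective (hc.nodes_disj _ _ f h1 h2)
    · exact fun e1 u => hc.map_notMem _ _
    · intro e1
      have : G.Occ t ((G.rhs p).lab e1) _ _ ((((G.rhs p).att e1).map gl).map a) :=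
        hc.occ (Sum.inr e1)
      rw [List.map_map] at this
      exact this
  have hIh : ∀ v ∈ Ih, (∃ u, a (Sum.inr u) = v) ∨ ∃ e', v ∈ Ie' (Sum.inr e') := by
    rintro v (⟨u, hu, rfl⟩ | h)
    · exact Or.inl ⟨⟨u, hu⟩, by rw [hglint u hu]⟩
    · exact Or.inr h
  refine ⟨fun v => a (Sum.inl v),
    fun e' => if h : e' = e then Fh else Fe' (Sum.inl ⟨e', h⟩),
    fun e' => if h : e' = e then Ih else Ie' (Sum.inl ⟨e', h⟩), ⟨⟨?_, ?_, ?_, ?_, ?_, ?_, ?_⟩, ?_⟩⟩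
  · exact hc.inj.comp Sum.inl_injective
  · intro f
    rw [hc.mem_edges]
    constructor
    · rintro ⟨e' | e', hf⟩
      · exact ⟨e', by simpa [e'.2] using hf⟩
      · exact ⟨e, by simpa using ⟨e', hf⟩⟩
    · rintro ⟨e', hf⟩
      by_cases h : e' = e
      · simp only [h, dite_true] at hf
        obtain ⟨e'', hf⟩ := hf
        exact ⟨Sum.inr e'', hf⟩
      · simp only [h, dite_false] at hf
        exact ⟨_, hf⟩
  · intro v
    rw [hc.mem_nodes]
    constructor
    · rintro (⟨u | u, hu, rfl⟩ | ⟨e' | e', hv⟩)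
      · exact Or.inl ⟨u, fun h => hu (List.mem_map_of_mem h), rfl⟩
      · refine Or.inr ⟨e, ?_⟩
        simp only [dite_true]
        exact Or.inl ⟨u, u.2, by rw [hglint u u.2]⟩
      · exact Or.inr ⟨e', by simpa [e'.2] using hv⟩
      · refine Or.inr ⟨e, ?_⟩
        simp only [dite_true]
        exact Or.inr ⟨e', hv⟩
    · rintro (⟨u, hu, rfl⟩ | ⟨e', hv⟩)
      · refine Or.inl ⟨Sum.inl u, fun h => hu ?_, rfl⟩
        obtain ⟨w, hw, h⟩ := List.mem_map.1 h
        exact Sum.inl_injective h ▸ hw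
      · by_cases h : e' = e
        · simp only [h, dite_true] at hv
          rcases hIh v hv with ⟨u, rfl⟩ | ⟨e'', hv⟩
          · refine Or.inl ⟨Sum.inr u, fun h => ?_, rfl⟩
            obtain ⟨w, hw, h⟩ := List.mem_map.1 h
            simp at h
          · exact Or.inr ⟨_, hv⟩
        · simp only [h, dite_false] at hv
          exact Or.inr ⟨_, hv⟩
  · rw [hc.ext_eq]
    exact List.map_map (l := g.ext) (f := Sum.inl) (g := a)
  · intro e1 e2 f h1 h2
    by_cases k1 : e1 = e <;> by_cases k2 : e2 = e <;>
      simp only [k1, k2, dite_true, dite_false] at h1 h2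
    · rw [k1, k2]
    · obtain ⟨_, h1⟩ := h1
      simpa using hc.edges_disj _ _ f h1 h2
    · obtain ⟨_, h2⟩ := h2
      simpa using hc.edges_disj _ _ f h1 h2
    · exact congrArg Subtype.val (Sum.inl_injective (hc.edges_disj _ _ f h1 h2))
  · intro e1 e2 f h1 h2
    by_cases k1 : e1 = e <;> by_cases k2 : e2 = e <;>
      simp only [k1, k2, dite_true, dite_false] at h1 h2
    · rw [k1, k2]
    · rcases hIh f h1 with ⟨u, rfl⟩ | ⟨_, h1⟩
      · exact absurd h2 (hc.map_notMem _ _)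
      · simpa using hc.nodes_disj _ _ f h1 h2
    · rcases hIh f h2 with ⟨u, rfl⟩ | ⟨_, h2⟩
      · exact absurd h1 (hc.map_notMem _ _)
      · simpa using hc.nodes_disj _ _ f h1 h2
    · exact congrArg Subtype.val (Sum.inl_injective (hc.nodes_disj _ _ f h1 h2))
  · intro e1 u h
    by_cases k1 : e1 = e <;> simp only [k1, dite_true, dite_false] at h
    · rcases hIh _ h with ⟨w, hw⟩ | ⟨_, h⟩
      · simpa using hc.inj hw
      · exact hc.map_notMem _ _ h
    · exact hc.map_notMem _ _ h
  · intro e1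
    by_cases k1 : e1 = e
    · subst k1
      simp only [dite_true]
      rw [he]
      exact hh.occ_rule
    · simp only [k1, dite_false]
      have : G.Occ t (g.lab e1) _ _ (((g.att e1).map Sum.inl).map a) := hc.occ (Sum.inl ⟨e1, k1⟩)
      rw [List.map_map] at this
      exact this

end HRGrammar

/-! ### Uniqueness of the generated hypergraph -/

namespace HRGrammar

variable {T : Type u} {rk : T → ℕ} {G : HRGrammar rk}

theorem IsStraightLine.rule_unique (hG : G.IsStraightLine) {p q : G.P}
    (h : G.lhs p = G.lhs q) : p = q :=
  (hG.existsUnique_rule _).unique h rfl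

open Classical in
/-- In a straight-line grammar nonterminals have weights that drop in every derivation step. -/
theorem IsStraightLine.exists_weight (hG : G.IsStraightLine) : ∃ w : G.N → ℕ,
    ∀ p, ∑ e, Sum.elim (fun _ => 0) w ((G.rhs p).lab e) < w (G.lhs p) := by
  choose r hr using fun A => (hG.existsUnique_rule A).exists
  obtain ⟨w, hw⟩ : ∃ w : G.N → ℕ,
      ∀ A, ∑ e, Sum.elim (fun _ => 0) w ((G.rhs (r A)).lab e) < w A := by
    refine ⟨hG.wellFounded.fix fun A rec => 1 + ∑ e, (match h : (G.rhs (r A)).lab e with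
      | Sum.inl _ => 0
      | Sum.inr B => rec B ⟨r A, hr A, e, h⟩), fun A => ?_⟩
    conv_rhs => rw [WellFounded.fix_eq]
    rw [add_comm, Nat.lt_succ_iff]
    refine Finset.sum_le_sum fun e _ => ?_
    split <;> rename_i h <;> simp [h]
  refine ⟨w, fun p => ?_⟩
  have := hw (G.lhs p)
  rwa [hG.rule_unique (hr (G.lhs p))] at this

/-- Two parts of terminal hypergraphs that are generated by the same sentential form are generated
by the same terminal hypergraph: rewriting can proceed simultaneously in both. -/
theorem Cover.exists_common_terminal (hG : G.IsStraightLine) {t₁ t₂ : HGraph rk}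
    {F₁ : Set t₁.E} {I₁ : Set t₁.V} {l₁ : List t₁.V} {F₂ : Set t₂.E} {I₂ : Set t₂.V}
    {l₂ : List t₂.V} {g : G.Graph} {α₁ Fe₁ Ie₁ α₂ Fe₂ Ie₂}
    (h₁ : G.Cover t₁ g α₁ Fe₁ Ie₁ F₁ I₁ l₁) (h₂ : G.Cover t₂ g α₂ Fe₂ Ie₂ F₂ I₂ l₂) :
    ∃ (k : G.Graph) (ι : g.V → k.V) (β₁ : k.V → t₁.V) (β₂ : k.V → t₂.V),
      (∀ e, ∃ a, k.lab e = Sum.inl a) ∧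
      (∃ Fe Ie, G.Cover t₁ k β₁ Fe Ie F₁ I₁ l₁) ∧ (∃ Fe Ie, G.Cover t₂ k β₂ Fe Ie F₂ I₂ l₂) ∧
      (∀ v, β₁ (ι v) = α₁ v) ∧ ∀ v, β₂ (ι v) = α₂ v := by
  classical
  obtain ⟨w, hw⟩ := hG.exists_weight
  induction hn : ∑ e, Sum.elim (fun _ => 0) w (g.lab e) using Nat.strong_induction_on
    generalizing g with
  | _ n ih =>
    subst hn
    by_cases hT : ∀ e, ∃ a, g.lab e = Sum.inl a
    · exact ⟨g, id, α₁, α₂, hT, ⟨_, _, h₁⟩, ⟨_, _, h₂⟩, fun _ => rfl, fun _ => rfl⟩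
    push Not at hT
    obtain ⟨e, he⟩ := hT
    obtain ⟨A, hA⟩ : ∃ A, g.lab e = Sum.inr A := by
      rcases h : g.lab e with a | A
      · exact absurd h (he a)
      · exact ⟨A, rfl⟩
    obtain ⟨p, rfl, -⟩ := hG.existsUnique_rule A
    have hp : ∀ q, G.lhs q = G.lhs p → q = p := fun q => hG.rule_unique
    obtain ⟨α₁', _, _, h₁', hα₁⟩ := h₁.expand e p hp hA
    obtain ⟨α₂', _, _, h₂', hα₂⟩ := h₂.expand e p hp hA
    have h1 : ∑ x : {e' : g.E // e' ≠ e} ⊕ (G.rhs p).E, Sum.elim (fun _ => 0) w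
        (Sum.elim (fun e' : {e' : g.E // e' ≠ e} => g.lab e') (G.rhs p).lab x) <
        ∑ e, Sum.elim (fun _ => 0) w (g.lab e) := by
      rw [Fintype.sum_sum_type]
      have h2 := hw p
      have h3 := Fintype.sum_eq_add_sum_subtype_ne
        (fun e => Sum.elim (fun _ => 0) w (g.lab e)) e
      simp only [Sum.elim_inl, Sum.elim_inr]
      simp only [hA, Sum.elim_inr] at h3
      omega
    obtain ⟨k, ι, β₁, β₂, hk, k₁, k₂, e₁, e₂⟩ := ih _
      ((Fintype.sum_equiv (Equiv.refl _) _ _ fun _ => rfl).trans_lt h1) h₁' h₂' rfl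
    exact ⟨k, fun v => ι (Sum.inl v), β₁, β₂, hk, k₁, k₂, fun v => (e₁ _).trans (hα₁ v),
      fun v => (e₂ _).trans (hα₂ v)⟩

/-- The maps `β` and `η` identify `k` with the part of `t` that has the edges `F`, the internal
nodes `I` and the external nodes `l`. -/
structure Embeds (k : G.Graph) (t : HGraph rk) (β : k.V → t.V) (η : k.E → t.E) (F : Set t.E)
    (I : Set t.V) (l : List t.V) : Prop where
  inj : Function.Injective β
  edge_inj : Function.Injective η
  mem_edges : ∀ f, f ∈ F ↔ ∃ e, η e = f
  mem_nodes : ∀ v, v ∈ I ↔ ∃ u, u ∉ k.ext ∧ β u = v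
  ext_eq : l = k.ext.map β
  att_eq : ∀ e, t.att (η e) = (k.att e).map β
  lab_eq : ∀ e, k.lab e = Sum.inl (t.lab (η e))

/-- A terminal sentential form is a copy of every part that it generates. -/
theorem Cover.exists_embeds {t : HGraph rk} {F : Set t.E} {I : Set t.V} {l : List t.V}
    {k : G.Graph} {β Fe Ie} (h : G.Cover t k β Fe Ie F I l)
    (hk : ∀ e, ∃ a, k.lab e = Sum.inl a) : ∃ η, Embeds k t β η F I l := by
  choose a ha using hk
  choose η h1 h2 h3 h4 using fun e => (h.occ e).exists_terminal (ha e)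
  refine ⟨η, h.inj, fun e e' he => ?_, fun f => ?_, fun v => ?_, h.ext_eq, fun e => (h4 e).symm,
    fun e => by rw [ha, h1]⟩
  · exact h.edges_disj e e' (η e) (by simp [h2]) (by simp [h2, he])
  · simp [h.mem_edges, h2, eq_comm]
  · simp [h.mem_nodes, h3]

namespace Embeds

variable {t : HGraph rk} {F : Set t.E} {I : Set t.V} {l : List t.V}
  {k : G.Graph} {β : k.V → t.V} {η : k.E → t.E}

theorem top_eq (h : Embeds k t β η F I l) (e : k.E) : t.top (η e) = β (k.top e) := by
  simp [HGraph.top, h.att_eq]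

theorem mem_tail_iff (h : Embeds k t β η F I l) {e : k.E} {u : k.V} :
    β u ∈ (t.att (η e)).tail ↔ u ∈ (k.att e).tail := by
  rw [h.att_eq, ← List.map_tail, List.mem_map_of_injective h.inj]

theorem map_mem_iff (h : Embeds k t β η F I l) {u : k.V} : β u ∈ I ↔ u ∉ k.ext := by
  rw [h.mem_nodes]
  exact ⟨fun ⟨u', hu', h'⟩ => h.inj h' ▸ hu', fun hu => ⟨u, hu, rfl⟩⟩

/-- Climbing only depends on the embedded hypergraph. -/
theorem climb_transfer {t' : HGraph rk} {F' : Set t'.E} {I' : Set t'.V} {l' : List t'.V}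
    {β' : k.V → t'.V} {η' : k.E → t'.E} (h : Embeds k t β η F I l)
    (h' : Embeds k t' β' η' F' I' l') (hI : ∀ v ∈ I, ∀ f, v ∈ t.att f → f ∈ F) {u : k.V} {w : t.V}
    (hc : t.Climb I (β u) w) : ∃ u', β u' = w ∧ t'.Climb I' (β' u) (β' u') := by
  generalize hv : β u = v at hc
  induction hc generalizing u with
  | refl hn =>
    subst hv
    rw [h.map_mem_iff, ← h'.map_mem_iff] at hn
    exact ⟨u, rfl, .refl hn⟩
  | @up _ _ f hm ht _ ih =>
    subst hv
    obtain ⟨e, rfl⟩ := (h.mem_edges f).1 (hI _ hm f (List.mem_of_mem_tail ht))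
    obtain ⟨u', hu', hc'⟩ := ih (h.top_eq e).symm
    rw [h.map_mem_iff, ← h'.map_mem_iff] at hm
    rw [← h'.top_eq] at hc'
    exact ⟨u', hu', .up hm (h'.mem_tail_iff.2 (h.mem_tail_iff.1 ht)) hc'⟩

end Embeds

/-- Two terminal hypergraphs that are generated by the same sentential form are isomorphic. -/
theorem Cover.isomorphic (hG : G.IsStraightLine) {t₁ t₂ : HGraph rk} {g : G.Graph}
    {α₁ Fe₁ Ie₁ α₂ Fe₂ Ie₂}
    (h₁ : G.Cover t₁ g α₁ Fe₁ Ie₁ Set.univ {v | v ∉ t₁.ext} t₁.ext)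
    (h₂ : G.Cover t₂ g α₂ Fe₂ Ie₂ Set.univ {v | v ∉ t₂.ext} t₂.ext) : t₁.Isomorphic t₂ := by
  obtain ⟨k, ι, β₁, β₂, hk, ⟨_, _, c₁⟩, ⟨_, _, c₂⟩, -, -⟩ := h₁.exists_common_terminal hG h₂
  obtain ⟨η₁, e₁⟩ := c₁.exists_embeds hk
  obtain ⟨η₂, e₂⟩ := c₂.exists_embeds hk
  have bij : ∀ {t : HGraph rk} {β : k.V → t.V} {η : k.E → t.E},
      Embeds k t β η Set.univ {v | v ∉ t.ext} t.ext →
        Function.Bijective β ∧ Function.Bijective η := by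
    intro t β η e
    refine ⟨⟨e.inj, fun v => ?_⟩, e.edge_inj, fun f => (e.mem_edges f).1 trivial⟩
    by_cases hv : v ∈ t.ext
    · rw [e.ext_eq] at hv
      obtain ⟨u, -, hu⟩ := List.mem_map.1 hv
      exact ⟨u, hu⟩
    · obtain ⟨u, -, hu⟩ := (e.mem_nodes v).1 hv
      exact ⟨u, hu⟩
  let b₁ := Equiv.ofBijective β₁ (bij e₁).1
  let b₂ := Equiv.ofBijective β₂ (bij e₂).1
  let c₁ := Equiv.ofBijective η₁ (bij e₁).2
  let c₂ := Equiv.ofBijective η₂ (bij e₂).2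
  have hb : ∀ u, b₁.symm (β₁ u) = u := fun u => b₁.symm_apply_apply u
  refine ⟨b₁.symm.trans b₂, c₁.symm.trans c₂, fun f => ?_, fun f => ?_, ?_⟩
  · obtain ⟨e, rfl⟩ := c₁.surjective f
    have : c₁.symm (c₁ e) = e := c₁.symm_apply_apply e
    simp only [Equiv.trans_apply, this]
    show t₂.att (η₂ e) = (t₁.att (η₁ e)).map _
    rw [e₁.att_eq, e₂.att_eq, List.map_map]
    refine List.map_congr_left fun u _ => ?_
    simp only [Function.comp_apply, Equiv.trans_apply, hb]
    rfl
  · obtain ⟨e, rfl⟩ := c₁.surjective f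
    have : c₁.symm (c₁ e) = e := c₁.symm_apply_apply e
    simp only [Equiv.trans_apply, this]
    show t₂.lab (η₂ e) = t₁.lab (η₁ e)
    exact Sum.inl_injective ((e₂.lab_eq e).symm.trans (e₁.lab_eq e))
  · rw [e₁.ext_eq, e₂.ext_eq, List.map_map]
    refine List.map_congr_left fun u _ => ?_
    simp only [Function.comp_apply, Equiv.trans_apply, hb]
    rfl

/-- Every generated terminal hypergraph is covered by the start graph. -/
theorem exists_cover_start {t : HGraph rk} (ht : t ∈ G.language) :
    ∃ α Fe Ie, G.Cover t G.start α Fe Ie Set.univ {v | v ∉ t.ext} t.ext := by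
  obtain ⟨g, hd, hiso⟩ := ht
  obtain ⟨f, k, hatt, hlab, hext⟩ : ∃ (f : g.V ≃ t.V) (k : g.E ≃ t.E),
    (∀ e, t.att (k e) = (g.att e).map f) ∧ (∀ e, Sum.inl (t.lab (k e)) = g.lab e) ∧
      t.ext = g.ext.map f := hiso
  have base : ∃ α Fe Ie, G.Cover t g α Fe Ie Set.univ {v | v ∉ t.ext} t.ext := by
    refine ⟨f, fun e => {k e}, fun _ => ∅, ⟨⟨f.injective, fun e => ?_, fun v => ?_, hext,
      ?_, ?_, ?_⟩, fun e => ?_⟩⟩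
    · simp only [Set.mem_univ, true_iff]
      exact ⟨k.symm e, (k.apply_symm_apply e).symm⟩
    · show v ∉ t.ext ↔ _
      simp only [Set.mem_empty_iff_false, exists_false, or_false, hext, List.mem_map, not_exists,
        not_and]
      constructor
      · exact fun h => ⟨f.symm v, fun h' => h _ h' (f.apply_symm_apply v), f.apply_symm_apply v⟩
      · rintro ⟨u, hu, rfl⟩ u' hu' h
        exact hu (f.injective h ▸ hu')
    · intro e e' x h h'
      exact k.injective ((Set.mem_singleton_iff.1 h).symm.trans (Set.mem_singleton_iff.1 h'))
    · exact fun _ _ _ h => absurd h (Set.notMem_empty _)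
    · exact fun _ _ => Set.notMem_empty _
    · rw [← hlab, ← hatt]
      exact Occ.terminal _
  clear hatt hlab hext
  generalize G.start = s at hd ⊢
  induction hd using Relation.ReflTransGen.head_induction_on with
  | refl => exact base
  | head hs _ ih =>
    obtain ⟨α, Fe, Ie, hc⟩ := ih
    cases hs with
    | mk e p h => exact hc.unexpand (he := h)

end HRGrammar

/-! ### Openings and links of a label -/

section Pick

open Classical in
/-- The sublist of the entries whose position satisfies `p`. Positions, unlike nodes, can be compared
between all lists of the same length. -/
noncomputable def List.pick {α : Type*} : (ℕ → Prop) → List α → List α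
  | _, [] => []
  | p, a :: l =>
    if p 0 then a :: List.pick (fun n => p (n + 1)) l else List.pick (fun n => p (n + 1)) l

open Classical in
theorem List.pick_eq_filter {α : Type*} {p : ℕ → Prop} {l : List α} {q : α → Prop}
    (h : ∀ k v, l[k]? = some v → (p k ↔ q v)) : l.pick p = l.filter (fun v => q v) := by
  induction l generalizing p with
  | nil => rfl
  | cons a l ih =>
    have h0 : p 0 ↔ q a := h 0 a rfl
    rw [List.pick, List.filter_cons, ih (p := fun n => p (n + 1)) fun k v hk => h (k + 1) v hk]
    simp [h0]

theorem List.pick_map {α β : Type*} (f : α → β) (p : ℕ → Prop) (l : List α) :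
    (l.map f).pick p = (l.pick p).map f := by
  induction l generalizing p with
  | nil => rfl
  | cons a l ih =>
    rw [List.map_cons, List.pick, List.pick, ih]
    split_ifs <;> simp

theorem List.pick_eq_self {α : Type*} {p : ℕ → Prop} {l : List α}
    (h : ∀ k < l.length, p k) : l.pick p = l := by
  induction l generalizing p with
  | nil => rfl
  | cons a l ih =>
    rw [List.pick, if_pos (h 0 (by simp)), ih fun k hk => h (k + 1) (by simpa using hk)]

open Classical in
theorem List.length_pick {α : Type*} (p : ℕ → Prop) (l : List α) :
    (l.pick p).length = ∑ k : Fin l.length, if p k then 1 else 0 := by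
  induction l generalizing p with
  | nil => rfl
  | cons a l ih =>
    have hs : ∑ k : Fin (a :: l).length, (if p k then 1 else 0) =
        (if p 0 then 1 else 0) + ∑ k : Fin l.length, if p (k + 1) then 1 else 0 :=
      Fin.sum_univ_succ _
    rw [hs, List.pick, ← ih fun n => p (n + 1)]
    split_ifs with h
    · rw [List.length_cons, add_comm]
    · rw [zero_add]

theorem List.length_pick_congr {α β : Type*} (p : ℕ → Prop) {l : List α} {l' : List β}
    (h : l.length = l'.length) : (l.pick p).length = (l'.pick p).length := by
  rw [List.length_pick, List.length_pick]
  exact Fintype.sum_equiv (finCongr h) _ _ fun _ => rfl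

end Pick

namespace HGraph

variable {T : Type u} {rk : T → ℕ}

/-- A part of a hypergraph, given by its edges, internal nodes and external nodes: it contains the
nodes of its edges, and the part meets the rest only in the external nodes. -/
structure IsPart (t : HGraph rk) (F : Set t.E) (I : Set t.V) (l : List t.V) : Prop where
  nodup : l.Nodup
  notMem : ∀ v ∈ l, v ∉ I
  mem_of_mem_att : ∀ f ∈ F, ∀ v ∈ t.att f, v ∈ I ∨ v ∈ l
  mem_edges : ∀ v ∈ I, ∀ f, v ∈ t.att f → f ∈ F
  notMem_ext : ∀ v ∈ I, v ∉ t.ext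

theorem isPart_univ (t : HGraph rk) : t.IsPart Set.univ {v | v ∉ t.ext} t.ext where
  nodup := t.ext_nodup
  notMem _ hv h := h hv
  mem_of_mem_att _ _ v _ := (em (v ∈ t.ext)).symm
  mem_edges _ _ _ _ := trivial
  notMem_ext _ h := h

/-- Some edge of `F` has `v` as its first node. -/
def Opens (t : HGraph rk) (F : Set t.E) (v : t.V) : Prop := ∃ f ∈ F, t.top f = v

/-- The node `v` is a child in an edge of `F` that lies in the component below `w`. -/
def Hangs (t : HGraph rk) (F : Set t.E) (I : Set t.V) (w v : t.V) : Prop :=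
  ∃ f ∈ F, v ∈ (t.att f).tail ∧ t.Climb I (t.top f) w

variable {t : HGraph rk} {F : Set t.E} {I : Set t.V} {l : List t.V} {v w w' : t.V}

namespace IsPart

theorem mem_of_climb (h : t.IsPart F I l) (hc : t.Climb I v w) (hv : v ∈ I ∨ v ∈ l) : w ∈ l := by
  induction hc with
  | refl hn => exact hv.resolve_left hn
  | @up v w f hm ht _ ih =>
    exact ih (h.mem_of_mem_att f (h.mem_edges v hm f (List.mem_of_mem_tail ht)) _ (t.top_mem_att f))

theorem opens_of_climb (h : t.IsPart F I l) (hc : t.Climb I v w) (hv : t.Opens F v) :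
    t.Opens F w := by
  induction hc with
  | refl hn => exact hv
  | @up v w f hm ht _ ih => exact ih ⟨f, h.mem_edges v hm f (List.mem_of_mem_tail ht), rfl⟩

theorem hangs_of_climb (h : t.IsPart F I l) (hc : t.Climb I v w) (hv : v ∈ I) :
    t.Hangs F I w v := by
  cases hc with
  | refl hn => exact absurd hv hn
  | @up _ _ f hm ht hc => exact ⟨f, h.mem_edges v hm f (List.mem_of_mem_tail ht), ht, hc⟩

theorem opens_of_hangs (h : t.IsPart F I l) (hv : t.Hangs F I w v) : t.Opens F w := by
  obtain ⟨f, hf, _, hc⟩ := hv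
  exact h.opens_of_climb hc ⟨f, hf, rfl⟩

end IsPart

theorem Hangs.climb (h : t.Hangs F I w v) (hv : v ∈ I) : t.Climb I v w := by
  obtain ⟨f, _, ht, hc⟩ := h
  exact .up hv ht hc

variable {root : t.V} {params : List t.V} {depth : t.V → ℕ}

theorem IsTreeWith.depth_lt_of_hangs (hT : t.IsTreeWith root params depth)
    (h : t.Hangs F I w v) : depth w < depth v := by
  obtain ⟨f, _, ht, hc⟩ := h
  exact (hT.depth_le_of_climb hc).trans_lt (hT.depth_lt f v ht)

theorem IsTreeWith.hangs_unique (hT : t.IsTreeWith root params depth)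
    (h : t.Hangs F I w v) (h' : t.Hangs F I w' v) : w = w' := by
  obtain ⟨f, _, ht, hc⟩ := h
  obtain ⟨f', _, ht', hc'⟩ := h'
  obtain rfl := hT.parent_unique _ _ _ ht ht'
  exact hT.climb_unique hc hc'

theorem IsTreeWith.root_notMem (hT : t.IsTreeWith root params depth) (h : t.IsPart F I l) :
    root ∉ I := fun hr => h.notMem_ext _ hr (by simp [hT.ext_eq])

end HGraph

namespace HRGrammar

variable {T : Type u} {rk : T → ℕ} {G : HRGrammar rk} {t : HGraph rk} {F F' : Set t.E}
  {I I' : Set t.V} {l l' : List t.V}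

/-- Inside a part, the edges of a cover generate parts again. -/
theorem Cover.isPart {g : G.Graph} {α Fe Ie} (hc : G.Cover t g α Fe Ie F I l)
    (hp : t.IsPart F I l) (e : g.E) : t.IsPart (Fe e) (Ie e) ((g.att e).map α) where
  nodup := (g.att_nodup e).map hc.inj
  notMem := by
    intro v hv
    obtain ⟨u, -, rfl⟩ := List.mem_map.1 hv
    exact hc.map_notMem e u
  mem_of_mem_att f hf v hv := (hc.occ e).mem_of_mem_att hf hv
  mem_edges v hv f hf := by
    obtain ⟨e', he'⟩ := (hc.mem_edges f).1
      (hp.mem_edges v ((hc.mem_nodes v).2 (Or.inr ⟨e, hv⟩)) f hf)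
    rcases (hc.occ e').mem_of_mem_att he' hf with h | h
    · rwa [hc.nodes_disj _ _ _ hv h]
    · obtain ⟨u, -, rfl⟩ := List.mem_map.1 h
      exact absurd hv (hc.map_notMem e u)
  notMem_ext v hv := hp.notMem_ext v ((hc.mem_nodes v).2 (Or.inr ⟨e, hv⟩))

theorem Cover.subset_edges {g : G.Graph} {α Fe Ie} (hc : G.Cover t g α Fe Ie F I l) (e : g.E) :
    Fe e ⊆ F := fun f hf => (hc.mem_edges f).2 ⟨e, hf⟩

theorem Cover.subset_nodes {g : G.Graph} {α Fe Ie} (hc : G.Cover t g α Fe Ie F I l) (e : g.E) :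
    Ie e ⊆ I := fun f hf => (hc.mem_nodes f).2 (Or.inr ⟨e, hf⟩)

theorem Cover.map_mem_iff {g : G.Graph} {α Fe Ie} (hc : G.Cover t g α Fe Ie F I l) {u : g.V} :
    α u ∈ I ↔ u ∉ g.ext := by
  rw [hc.mem_nodes]
  constructor
  · rintro (⟨u', hu', h'⟩ | ⟨e, he⟩)
    · exact hc.inj h' ▸ hu'
    · exact absurd he (hc.map_notMem e u)
  · exact fun hu => Or.inl ⟨u, hu, rfl⟩

section Transfer

variable (hG : G.IsStraightLine) {g : G.Graph} {α Fe Ie α' Fe' Ie'}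
  (hc : G.Cover t g α Fe Ie F I l) (hp : t.IsPart F I l) (hc' : G.Cover t g α' Fe' Ie' F' I' l')

include hG hc hc'

/-- Whether a node of `g` is the first node of an edge of the generated part depends on `g` only;
the same holds for climbing and hanging between nodes of `g`. -/
theorem Cover.opens_transfer {v : g.V} (h : t.Opens F (α v)) : t.Opens F' (α' v) := by
  obtain ⟨k, ι, β₁, β₂, hk, ⟨_, _, c₁⟩, ⟨_, _, c₂⟩, h₁, h₂⟩ := hc.exists_common_terminal hG hc'
  obtain ⟨η₁, e₁⟩ := c₁.exists_embeds hk
  obtain ⟨η₂, e₂⟩ := c₂.exists_embeds hk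
  obtain ⟨f, hf, ht⟩ := h
  obtain ⟨e, rfl⟩ := (e₁.mem_edges f).1 hf
  rw [e₁.top_eq, ← h₁] at ht
  exact ⟨η₂ e, (e₂.mem_edges _).2 ⟨e, rfl⟩, by rw [e₂.top_eq, e₁.inj ht, h₂]⟩

include hp

theorem Cover.climb_transfer {v w : g.V} (h : t.Climb I (α v) (α w)) :
    t.Climb I' (α' v) (α' w) := by
  obtain ⟨k, ι, β₁, β₂, hk, ⟨_, _, c₁⟩, ⟨_, _, c₂⟩, h₁, h₂⟩ := hc.exists_common_terminal hG hc'
  obtain ⟨η₁, e₁⟩ := c₁.exists_embeds hk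
  obtain ⟨η₂, e₂⟩ := c₂.exists_embeds hk
  rw [← h₁, ← h₁] at h
  obtain ⟨u, hu, h⟩ := e₁.climb_transfer e₂ hp.mem_edges h
  rwa [e₁.inj hu, h₂, h₂] at h

theorem Cover.hangs_transfer {v w : g.V} (h : t.Hangs F I (α w) (α v)) :
    t.Hangs F' I' (α' w) (α' v) := by
  obtain ⟨k, ι, β₁, β₂, hk, ⟨_, _, c₁⟩, ⟨_, _, c₂⟩, h₁, h₂⟩ := hc.exists_common_terminal hG hc'
  obtain ⟨η₁, e₁⟩ := c₁.exists_embeds hk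
  obtain ⟨η₂, e₂⟩ := c₂.exists_embeds hk
  obtain ⟨f, hf, ht, hcl⟩ := h
  obtain ⟨e, rfl⟩ := (e₁.mem_edges f).1 hf
  rw [← h₁, e₁.mem_tail_iff] at ht
  rw [← h₁, e₁.top_eq] at hcl
  obtain ⟨u, hu, hcl⟩ := e₁.climb_transfer e₂ hp.mem_edges hcl
  rw [e₁.inj hu, h₂, ← e₂.top_eq] at hcl
  exact ⟨η₂ e, (e₂.mem_edges _).2 ⟨e, rfl⟩, by rwa [← h₂, e₂.mem_tail_iff], hcl⟩

end Transfer

variable (G t) in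
/-- The `j`-th external node of a part generated by `x` is the first node of an edge of it. -/
def Opening (x : T ⊕ G.N) (j : ℕ) : Prop :=
  ∃ F I l, G.Occ t x F I l ∧ t.IsPart F I l ∧ ∃ v, l[j]? = some v ∧ t.Opens F v

variable (G t) in
/-- In a part generated by `x`, the `k`-th external node is a leaf of the component whose root is
the `j`-th external node. -/
def Link (x : T ⊕ G.N) (j k : ℕ) : Prop :=
  ∃ F I l, G.Occ t x F I l ∧ t.IsPart F I l ∧
    ∃ w v, l[j]? = some w ∧ l[k]? = some v ∧ t.Hangs F I w v

theorem Cover.exists_getElem? {g : G.Graph} {α Fe Ie} (hc : G.Cover t g α Fe Ie F I l) {j : ℕ}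
    {v : t.V} (h : l[j]? = some v) : ∃ u, g.ext[j]? = some u ∧ α u = v := by
  rw [hc.ext_eq, List.getElem?_map] at h
  simpa using h

theorem Cover.getElem? {g : G.Graph} {α Fe Ie} (hc : G.Cover t g α Fe Ie F I l) {j : ℕ}
    {u : g.V} (h : g.ext[j]? = some u) : l[j]? = some (α u) := by
  rw [hc.ext_eq, List.getElem?_map, h]
  rfl

theorem getElem?_att_eq_top_iff (f : t.E) {j : ℕ} {v : t.V} (h : (t.att f)[j]? = some v) :
    t.top f = v ↔ j = 0 := by
  rw [t.att_eq_top_cons] at h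
  have hn := t.att_nodup f
  rw [t.att_eq_top_cons, List.nodup_cons] at hn
  cases j with
  | zero => simpa using h
  | succ j =>
    simp only [List.getElem?_cons_succ] at h
    simp only [Nat.add_eq_zero_iff, one_ne_zero, and_false, iff_false]
    rintro rfl
    exact hn.1 (List.mem_of_getElem? h)

theorem getElem?_att_mem_tail_iff (f : t.E) {j : ℕ} {v : t.V} (h : (t.att f)[j]? = some v) :
    v ∈ (t.att f).tail ↔ j ≠ 0 := by
  rw [Ne, ← getElem?_att_eq_top_iff f h]
  have hn := t.att_nodup f
  rw [t.att_eq_top_cons, List.nodup_cons] at hn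
  have hm := List.mem_of_getElem? h
  rw [t.att_eq_top_cons, List.mem_cons] at hm
  constructor
  · rintro hv rfl
    exact hn.1 hv
  · exact fun hv => hm.resolve_left fun h => hv h.symm

theorem opens_singleton_iff (f : t.E) {j : ℕ} {v : t.V} (h : (t.att f)[j]? = some v) :
    t.Opens {f} v ↔ j = 0 := by
  rw [← getElem?_att_eq_top_iff f h]
  simp [HGraph.Opens]

theorem hangs_singleton_iff (f : t.E) {j k : ℕ} {v w : t.V} (hw : (t.att f)[j]? = some w)
    (hv : (t.att f)[k]? = some v) : t.Hangs {f} ∅ w v ↔ j = 0 ∧ k ≠ 0 := by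
  rw [← getElem?_att_eq_top_iff f hw, ← getElem?_att_mem_tail_iff f hv]
  constructor
  · rintro ⟨f', rfl, ht, hc⟩
    exact ⟨hc.eq_of_notMem (Set.notMem_empty _), ht⟩
  · rintro ⟨rfl, ht⟩
    exact ⟨f, rfl, ht, .refl (Set.notMem_empty _)⟩

/-- All occurrences of a label have the same openings. -/
theorem Occ.opening_iff (hG : G.IsStraightLine) {x : T ⊕ G.N} (ho : G.Occ t x F I l)
    (hp : t.IsPart F I l) {j : ℕ} {v : t.V} (hv : l[j]? = some v) :
    G.Opening t x j ↔ t.Opens F v := by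
  refine ⟨?_, fun h => ⟨F, I, l, ho, hp, v, hv, h⟩⟩
  rintro ⟨F', I', l', ho', hp', v', hv', h'⟩
  rcases x with a | A
  · obtain ⟨f, -, rfl, rfl, rfl⟩ := ho.exists_terminal rfl
    obtain ⟨f', -, rfl, rfl, rfl⟩ := ho'.exists_terminal rfl
    rw [opens_singleton_iff f hv, ← opens_singleton_iff f' hv']
    exact h'
  · obtain ⟨p, rfl, α, Fe, Ie, hc⟩ := ho.exists_cover rfl
    obtain ⟨p', hpp, α', Fe', Ie', hc'⟩ := ho'.exists_cover rfl
    obtain rfl := hG.rule_unique hpp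
    obtain ⟨u, hu, rfl⟩ := hc.exists_getElem? hv
    rw [hc'.getElem? hu, Option.some.injEq] at hv'
    subst hv'
    exact hc'.opens_transfer hG hc h'

/-- All occurrences of a label have the same links. -/
theorem Occ.link_iff (hG : G.IsStraightLine) {x : T ⊕ G.N} (ho : G.Occ t x F I l)
    (hp : t.IsPart F I l) {j k : ℕ} {v w : t.V} (hw : l[j]? = some w) (hv : l[k]? = some v) :
    G.Link t x j k ↔ t.Hangs F I w v := by
  refine ⟨?_, fun h => ⟨F, I, l, ho, hp, w, v, hw, hv, h⟩⟩
  rintro ⟨F', I', l', ho', hp', w', v', hw', hv', h'⟩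
  rcases x with a | A
  · obtain ⟨f, -, rfl, rfl, rfl⟩ := ho.exists_terminal rfl
    obtain ⟨f', -, rfl, rfl, rfl⟩ := ho'.exists_terminal rfl
    rw [hangs_singleton_iff f hw hv, ← hangs_singleton_iff f' hw' hv']
    exact h'
  · obtain ⟨p, rfl, α, Fe, Ie, hc⟩ := ho.exists_cover rfl
    obtain ⟨p', hpp, α', Fe', Ie', hc'⟩ := ho'.exists_cover rfl
    obtain rfl := hG.rule_unique hpp
    obtain ⟨u, hu, rfl⟩ := hc.exists_getElem? hv
    obtain ⟨z, hz, rfl⟩ := hc.exists_getElem? hw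
    rw [hc'.getElem? hu, Option.some.injEq] at hv'
    rw [hc'.getElem? hz, Option.some.injEq] at hw'
    subst hv' hw'
    exact hc'.hangs_transfer hG hp' hc h'

variable (G t) in
/-- The sentential form `g` generates a part of `t`. -/
def Placed (g : G.Graph) : Prop :=
  ∃ α Fe Ie F I l, G.Cover t g α Fe Ie F I l ∧ t.IsPart F I l

variable (G t) in
/-- In a part generated by `g`, going up through internal nodes leads from `v` to `r`. -/
def Climbs (g : G.Graph) (r v : g.V) : Prop :=
  ∃ α Fe Ie F I l, G.Cover t g α Fe Ie F I l ∧ t.IsPart F I l ∧ t.Climb I (α v) (α r)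

variable (G t) in
/-- In a part generated by `g`, the node `v` is a child in the component with root `r`. -/
def HangsBelow (g : G.Graph) (r v : g.V) : Prop :=
  ∃ α Fe Ie F I l, G.Cover t g α Fe Ie F I l ∧ t.IsPart F I l ∧ t.Hangs F I (α r) (α v)

section Iff

variable (hG : G.IsStraightLine) {g : G.Graph} {α Fe Ie}
  (hc : G.Cover t g α Fe Ie F I l) (hp : t.IsPart F I l)

include hG hc hp

theorem Cover.climbs_iff {r v : g.V} : G.Climbs t g r v ↔ t.Climb I (α v) (α r) := by
  refine ⟨?_, fun h => ⟨α, Fe, Ie, F, I, l, hc, hp, h⟩⟩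
  rintro ⟨α', Fe', Ie', F', I', l', hc', hp', h⟩
  exact hc'.climb_transfer hG hp' hc h

theorem Cover.hangsBelow_iff {r v : g.V} :
    G.HangsBelow t g r v ↔ t.Hangs F I (α r) (α v) := by
  refine ⟨?_, fun h => ⟨α, Fe, Ie, F, I, l, hc, hp, h⟩⟩
  rintro ⟨α', Fe', Ie', F', I', l', hc', hp', h⟩
  exact hc'.hangs_transfer hG hp' hc h

theorem Cover.opening_iff {e : g.E} {j : ℕ} {v : g.V} (hv : (g.att e)[j]? = some v) :
    G.Opening t (g.lab e) j ↔ t.Opens (Fe e) (α v) :=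
  (hc.occ e).opening_iff hG (hc.isPart hp e) (by rw [List.getElem?_map, hv]; rfl)

theorem Cover.link_iff {e : g.E} {j k : ℕ} {v w : g.V} (hw : (g.att e)[j]? = some w)
    (hv : (g.att e)[k]? = some v) :
    G.Link t (g.lab e) j k ↔ t.Hangs (Fe e) (Ie e) (α w) (α v) :=
  (hc.occ e).link_iff hG (hc.isPart hp e) (by rw [List.getElem?_map, hw]; rfl)
    (by rw [List.getElem?_map, hv]; rfl)

open Classical in
theorem Cover.pick_link_eq {e : g.E} {j : ℕ} {w : g.V} (hw : (g.att e)[j]? = some w) :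
    (g.att e).pick (G.Link t (g.lab e) j) =
      (g.att e).filter (fun v => t.Hangs (Fe e) (Ie e) (α w) (α v)) :=
  List.pick_eq_filter fun _ _ hv => hc.link_iff hG hp hw hv

theorem Cover.mem_pick_link_iff {e : g.E} {j : ℕ} {v w : g.V} (hw : (g.att e)[j]? = some w) :
    v ∈ (g.att e).pick (G.Link t (g.lab e) j) ↔
      v ∈ g.att e ∧ t.Hangs (Fe e) (Ie e) (α w) (α v) := by
  rw [hc.pick_link_eq hG hp hw]
  simp

end Iff

end HRGrammar

/-! ### Components of a sentential form -/

namespace HRGrammar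

variable {T : Type u} {rk : T → ℕ} {G : HRGrammar rk} {t : HGraph rk} {F : Set t.E}
  {I : Set t.V} {l : List t.V} {root : t.V} {params : List t.V} {depth : t.V → ℕ}

variable (G t) in
/-- The nonterminals of the tree grammar: a nonterminal `A` of `G` together with the position of an
external node that is the root of a component of the hypergraph generated by `A`. -/
abbrev Component : Type := {q : Σ A : G.N, Fin (G.nrk A) // G.Opening t (Sum.inr q.1) q.2}

variable (G t) in
/-- The rank of a component: its root and its leaves among the external nodes. -/
noncomputable def componentRank (q : G.Component t) : ℕ :=
  ((List.range (G.nrk q.1.1)).pick (G.Link t (Sum.inr q.1.1) q.1.2)).length + 1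

/-- The label of the component at position `j` of an edge with label `x`. -/
def componentLabel : (x : T ⊕ G.N) → (j : ℕ) → j < Sum.elim rk G.nrk x → G.Opening t x j →
    T ⊕ G.Component t
  | Sum.inl a, _, _, _ => Sum.inl a
  | Sum.inr A, j, hj, ho => Sum.inr ⟨⟨A, ⟨j, hj⟩⟩, ho⟩

/-- A terminal edge is a single component, with all its other nodes as leaves. -/
theorem pick_link_terminal (hG : G.IsStraightLine) {f : t.E} (hp : t.IsPart {f} ∅ (t.att f)) :
    (t.att f).pick (G.Link t (Sum.inl (t.lab f)) 0) = (t.att f).tail := by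
  have hl : ∀ k, k < (t.att f).length → (G.Link t (Sum.inl (t.lab f)) 0 k ↔ k ≠ 0) := by
    intro k hk
    have h0 : 0 < (t.att f).length := by omega
    rw [(Occ.terminal f).link_iff hG hp (List.getElem?_eq_getElem h0)
      (List.getElem?_eq_getElem hk), hangs_singleton_iff f (List.getElem?_eq_getElem h0)
      (List.getElem?_eq_getElem hk)]
    simp
  generalize t.att f = l at hl
  cases l with
  | nil => rfl
  | cons a l =>
    rw [List.pick, if_neg, List.tail_cons, List.pick_eq_self]
    · exact fun k hk => (hl (k + 1) (by simpa using hk)).2 (by simp)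
    · rw [hl 0 (by simp)]
      simp

theorem Opening.terminal {a : T} {j : ℕ} (h : G.Opening t (Sum.inl a) j) :
    j = 0 ∧ ∃ f, t.lab f = a ∧ t.IsPart {f} ∅ (t.att f) := by
  obtain ⟨F, I, l, ho, hp, v, hv, h⟩ := h
  obtain ⟨f, rfl, rfl, rfl, rfl⟩ := ho.exists_terminal rfl
  exact ⟨(opens_singleton_iff f hv).1 h, f, rfl, hp⟩

theorem rank_componentLabel (hG : G.IsStraightLine) {x : T ⊕ G.N} {j : ℕ}
    (hj : j < Sum.elim rk G.nrk x) (ho : G.Opening t x j) {V : Type*} {l : List V}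
    (hl : l.length = Sum.elim rk G.nrk x) :
    Sum.elim rk (G.componentRank t) (componentLabel x j hj ho) =
      (l.pick (G.Link t x j)).length + 1 := by
  rcases x with a | A
  · obtain ⟨rfl, f, rfl, hp⟩ := ho.terminal
    rw [List.length_pick_congr (l' := t.att f) _ (by rw [hl, t.att_rank]; rfl),
      pick_link_terminal hG hp]
    have := t.att_rank f
    rw [t.att_eq_top_cons] at this
    exact this.symm
  · show ((List.range (G.nrk A)).pick _).length + 1 = _
    rw [List.length_pick_congr (l' := l) _ (by rw [hl, List.length_range]; rfl)]

variable (G t) in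
/-- The nodes of the component of `g` with root `r`. -/
def InComponent (g : G.Graph) (r v : g.V) : Prop := G.Climbs t g r v ∨ G.HangsBelow t g r v

theorem not_link_self (hT : t.IsTreeWith root params depth) (x : T ⊕ G.N) (j : ℕ) :
    ¬ G.Link t x j j := by
  rintro ⟨F, I, l, _, _, w, v, hw, hv, h⟩
  rw [hw, Option.some.injEq] at hv
  subst hv
  exact (hT.depth_lt_of_hangs h).ne rfl

theorem nodup_cons_pick {V : Type*} {l : List V} (hl : l.Nodup) {p : ℕ → Prop} {j : ℕ}
    (hj : j < l.length) (hp : ¬ p j) : (l[j] :: l.pick p).Nodup := by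
  classical
  have h := List.pick_eq_filter (p := p) (l := l) (q := fun v => ∃ k, l[k]? = some v ∧ p k)
    fun k v hk => ⟨fun h => ⟨k, hk, h⟩, ?_⟩
  · rw [h, List.nodup_cons]
    refine ⟨?_, hl.filter _⟩
    simp only [List.mem_filter, decide_eq_true_eq, not_and, not_exists]
    rintro - k hk hpk
    obtain ⟨hk', hk⟩ := List.getElem?_eq_some_iff.1 hk
    rw [hl.getElem_inj_iff] at hk
    exact hp (hk ▸ hpk)
  · rintro ⟨k', hk', h⟩
    obtain ⟨h1, h2⟩ := List.getElem?_eq_some_iff.1 hk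
    obtain ⟨h3, h4⟩ := List.getElem?_eq_some_iff.1 hk'
    rw [← h4, hl.getElem_inj_iff] at h2
    exact h2 ▸ h

section Climbing

variable {g : G.Graph} {α Fe Ie} (hc : G.Cover t g α Fe Ie F I l) (hp : t.IsPart F I l)

include hc hp

/-- The first part of the way up from an edge of `Fe e` stays inside `Ie e` and leads to a node
attached to `e` at which a component of `e` is rooted. -/
theorem Cover.exists_climb_att (hT : t.IsTreeWith root params depth) {e : g.E} {f : t.E}
    (hf : f ∈ Fe e) : ∃ u ∈ g.att e, t.Climb (Ie e) (t.top f) (α u) ∧ t.Opens (Fe e) (α u) := by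
  have hpe := hc.isPart hp e
  obtain ⟨w, hw⟩ := hT.exists_climb (hT.root_notMem hpe) (t.top f)
  have := hpe.mem_of_climb hw (hpe.mem_of_mem_att f hf _ (t.top_mem_att f))
  obtain ⟨u, hu, rfl⟩ := List.mem_map.1 this
  exact ⟨u, hu, hw, hpe.opens_of_climb hw ⟨f, hf, rfl⟩⟩

theorem Cover.mem_att_of_mem {e : g.E} {f : t.E} (hf : f ∈ Fe e) {v : g.V}
    (hv : α v ∈ t.att f) : v ∈ g.att e := by
  rcases (hc.isPart hp e).mem_of_mem_att f hf _ hv with h | h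
  · exact absurd h (hc.map_notMem e v)
  · exact (List.mem_map_of_injective hc.inj).1 h

end Climbing

theorem Cover.climbs_self (hG : G.IsStraightLine) {g : G.Graph} {α Fe Ie}
    (hc : G.Cover t g α Fe Ie F I l) (hp : t.IsPart F I l) {r : g.V} (hr : r ∈ g.ext) :
    G.Climbs t g r r :=
  (hc.climbs_iff hG hp).2 (.refl (by rw [hc.map_mem_iff]; exact not_not.2 hr))

open Classical in
variable (G t) in
/-- The leaves of the component with root `r` among the external nodes of `g`. -/
noncomputable def leaves (g : G.Graph) (r : g.V) : List g.V :=
  g.ext.filter fun v => G.HangsBelow t g r v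

theorem mem_leaves {g : G.Graph} {r v : g.V} :
    v ∈ G.leaves t g r ↔ v ∈ g.ext ∧ G.HangsBelow t g r v := by
  simp [leaves]

theorem Placed.inComponent_of_mem_ext (hG : G.IsStraightLine) {g : G.Graph} (hg : G.Placed t g)
    {r : g.V} (hr : r ∈ g.ext) : ∀ v ∈ r :: G.leaves t g r, G.InComponent t g r v := by
  intro v hv
  rcases List.mem_cons.1 hv with rfl | hv
  · obtain ⟨α, Fe, Ie, F, I, l, hc, hp⟩ := hg
    exact Or.inl (hc.climbs_self hG hp hr)
  · exact Or.inr (mem_leaves.1 hv).2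

theorem Placed.inComponent_of_link (hG : G.IsStraightLine) {g : G.Graph} (hg : G.Placed t g)
    {r : g.V} {e : g.E} {j : ℕ} (hj : j < (g.att e).length) (h : G.Climbs t g r (g.att e)[j])
    {v : g.V} (hv : v ∈ (g.att e)[j] :: (g.att e).pick (G.Link t (g.lab e) j)) :
    G.InComponent t g r v := by
  obtain ⟨α, Fe, Ie, F, I, l, hc, hp⟩ := hg
  rcases List.mem_cons.1 hv with rfl | hv
  · exact Or.inl h
  · obtain ⟨hv, f, hf, ht, hcl⟩ :=
      (hc.mem_pick_link_iff hG hp (List.getElem?_eq_getElem hj)).1 hv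
    rw [hc.climbs_iff hG hp] at h
    exact Or.inr ((hc.hangsBelow_iff hG hp).2
      ⟨f, hc.subset_edges e hf, ht, hcl.trans (hc.subset_nodes e) h⟩)

/-- The component of `g` with root `r`. Every edge `e` of `g` is replaced by its components; the
component of `e` with root `u` belongs to the component of `g` with root `r` if `u` lies below `r`
with only internal nodes of the generated hypergraph in between. -/
noncomputable def piece (hG : G.IsStraightLine) (hT : t.IsTreeWith root params depth)
    (g : G.Graph) (hg : G.Placed t g) (r : g.V) (hr : r ∈ g.ext) :
    HGraph (Sum.elim rk (G.componentRank t)) where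
  V := {v // G.InComponent t g r v}
  E := {q : Σ e : g.E, Fin (g.att e).length //
    G.Opening t (g.lab q.1) q.2 ∧ G.Climbs t g r (g.att q.1)[q.2]}
  fintypeV := Fintype.ofFinite _
  nonemptyV := by
    exact ⟨r, hg.inComponent_of_mem_ext hG hr r List.mem_cons_self⟩
  fintypeE := Fintype.ofFinite _
  att q := ((g.att q.1.1)[q.1.2] ::
    (g.att q.1.1).pick (G.Link t (g.lab q.1.1) q.1.2)).attachWith _ fun _ =>
      hg.inComponent_of_link hG q.1.2.2 q.2.2
  lab q := componentLabel (g.lab q.1.1) q.1.2 (q.1.2.2.trans_eq (g.att_rank q.1.1)) q.2.1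
  ext := (r :: G.leaves t g r).attachWith _ (hg.inComponent_of_mem_ext hG hr)
  att_ne q := by simp
  att_nodup q := by
    refine List.Nodup.of_map Subtype.val ?_
    rw [List.attachWith_map_subtype_val]
    exact nodup_cons_pick (g.att_nodup _) _ (not_link_self hT _ _)
  att_rank q := by
    rw [rank_componentLabel hG _ _ (g.att_rank q.1.1), List.length_attachWith, List.length_cons]
  ext_nodup := by
    classical
    refine List.Nodup.of_map Subtype.val ?_
    rw [List.attachWith_map_subtype_val]
    obtain ⟨α, Fe, Ie, F, I, l, hc, hp⟩ := hg
    rw [List.nodup_cons, mem_leaves, hc.hangsBelow_iff hG hp]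
    exact ⟨fun h => (hT.depth_lt_of_hangs h.2).ne rfl, g.ext_nodup.filter _⟩

section Piece

variable {hG : G.IsStraightLine} {hT : t.IsTreeWith root params depth}
  {g : G.Graph} {hg : G.Placed t g} {r : g.V} {hr : r ∈ g.ext}

/-- A node of a component as a node of the whole hypergraph. -/
def pieceNode (v : (piece hG hT g hg r hr).V) : g.V := Subtype.val v

theorem pieceNode_injective :
    Function.Injective (pieceNode : (piece hG hT g hg r hr).V → g.V) := Subtype.val_injective

theorem inComponent_pieceNode (v : (piece hG hT g hg r hr).V) :
    G.InComponent t g r (pieceNode v) := Subtype.property v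

/-- The edge of the whole hypergraph that an edge of a component comes from. -/
def pieceEdge (q : (piece hG hT g hg r hr).E) : g.E := (Subtype.val q).1

/-- The position, in the edge it comes from, of the first node of an edge of a component. -/
def piecePos (q : (piece hG hT g hg r hr).E) : ℕ := (Subtype.val q).2

/-- The first node of an edge of a component as a node of the whole hypergraph. -/
def pieceTop (q : (piece hG hT g hg r hr).E) : g.V :=
  (g.att (Subtype.val q).1)[(Subtype.val q).2]

theorem getElem?_piecePos (q : (piece hG hT g hg r hr).E) :
    (g.att (pieceEdge q))[piecePos q]? = some (pieceTop q) :=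
  List.getElem?_eq_getElem (Subtype.val q).2.2

theorem pieceTop_mem (q : (piece hG hT g hg r hr).E) : pieceTop q ∈ g.att (pieceEdge q) :=
  List.mem_of_getElem? (getElem?_piecePos q)

theorem opening_piece (q : (piece hG hT g hg r hr).E) :
    G.Opening t (g.lab (pieceEdge q)) (piecePos q) := (Subtype.property q).1

theorem climbs_pieceTop (q : (piece hG hT g hg r hr).E) : G.Climbs t g r (pieceTop q) :=
  (Subtype.property q).2

theorem piecePos_lt (q : (piece hG hT g hg r hr).E) :
    piecePos q < Sum.elim rk G.nrk (g.lab (pieceEdge q)) :=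
  (Subtype.val q).2.2.trans_eq (g.att_rank _)

theorem map_att_piece (q : (piece hG hT g hg r hr).E) :
    ((piece hG hT g hg r hr).att q).map pieceNode =
      pieceTop q :: (g.att (pieceEdge q)).pick (G.Link t (g.lab (pieceEdge q)) (piecePos q)) :=
  List.attachWith_map_subtype_val _

theorem map_ext_piece :
    (piece hG hT g hg r hr).ext.map pieceNode = r :: G.leaves t g r :=
  List.attachWith_map_subtype_val _

theorem pieceEdge_ext {q q' : (piece hG hT g hg r hr).E} (h : pieceEdge q = pieceEdge q')
    (h' : pieceTop q = pieceTop q') : q = q' := by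
  obtain ⟨⟨e, j⟩, hq⟩ := q
  obtain ⟨⟨e', j'⟩, hq'⟩ := q'
  obtain rfl : e = e' := h
  have hj' : (g.att e)[j.1] = (g.att e)[j'.1] := h'
  rw [(g.att_nodup e).getElem_inj_iff] at hj'
  have : j = j' := Fin.ext hj'
  subst this
  rfl

variable (hG hT hg hr) in
theorem exists_pieceEdge {e : g.E} {j : ℕ} {u : g.V} (hj : (g.att e)[j]? = some u)
    (ho : G.Opening t (g.lab e) j) (hcl : G.Climbs t g r u) :
    ∃ q : (piece hG hT g hg r hr).E, pieceEdge q = e ∧ piecePos q = j ∧ pieceTop q = u := by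
  obtain ⟨h, rfl⟩ := List.getElem?_eq_some_iff.1 hj
  exact ⟨⟨⟨e, ⟨j, h⟩⟩, ho, hcl⟩, rfl, rfl, rfl⟩

theorem pieceNode_top (q : (piece hG hT g hg r hr).E) :
    pieceNode ((piece hG hT g hg r hr).top q) = pieceTop q := by
  have h := map_att_piece q
  rw [HGraph.att_eq_top_cons, List.map_cons] at h
  exact (List.cons.inj h).1

section Cover

variable {α Fe Ie} (hc : G.Cover t g α Fe Ie F I l) (hp : t.IsPart F I l)

include hc hp

theorem mem_tail_piece_iff (q : (piece hG hT g hg r hr).E) (v : (piece hG hT g hg r hr).V) :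
    v ∈ ((piece hG hT g hg r hr).att q).tail ↔ pieceNode v ∈ g.att (pieceEdge q) ∧
      t.Hangs (Fe (pieceEdge q)) (Ie (pieceEdge q)) (α (pieceTop q)) (α (pieceNode v)) := by
  have h := map_att_piece q
  rw [HGraph.att_eq_top_cons, List.map_cons] at h
  rw [← List.mem_map_of_injective pieceNode_injective, (List.cons.inj h).2]
  exact hc.mem_pick_link_iff hG hp (getElem?_piecePos q)

theorem opens_pieceTop (q : (piece hG hT g hg r hr).E) :
    t.Opens (Fe (pieceEdge q)) (α (pieceTop q)) := by
  rw [← hc.opening_iff hG hp (getElem?_piecePos q)]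
  exact opening_piece q

theorem climb_pieceTop (q : (piece hG hT g hg r hr).E) : t.Climb I (α (pieceTop q)) (α r) := by
  rw [← hc.climbs_iff hG hp]
  exact climbs_pieceTop q

theorem climb_or_hangs_pieceNode (v : (piece hG hT g hg r hr).V) :
    t.Climb I (α (pieceNode v)) (α r) ∨ t.Hangs F I (α r) (α (pieceNode v)) := by
  rw [← hc.climbs_iff hG hp, ← hc.hangsBelow_iff hG hp]
  exact inComponent_pieceNode v

variable (hG hT hg hr) in
theorem exists_pieceEdge_of_opens {e : g.E} {u : g.V} (hu : u ∈ g.att e)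
    (ho : t.Opens (Fe e) (α u)) (hcl : t.Climb I (α u) (α r)) :
    ∃ q : (piece hG hT g hg r hr).E, pieceEdge q = e ∧ pieceTop q = u := by
  obtain ⟨j, hj⟩ := List.getElem?_of_mem hu
  obtain ⟨q, h1, -, h3⟩ := exists_pieceEdge hG hT hg hr hj ((hc.opening_iff hG hp hj).2 ho)
    ((hc.climbs_iff hG hp).2 hcl)
  exact ⟨q, h1, h3⟩

variable (hG hT hg hr) in
/-- Every edge of the generated component is generated by an edge of `piece`. -/
theorem exists_pieceEdge_of_climb {e : g.E} {f : t.E} (hf : f ∈ Fe e)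
    (hcl : t.Climb I (t.top f) (α r)) : ∃ q : (piece hG hT g hg r hr).E,
      pieceEdge q = e ∧ t.Climb (Ie e) (t.top f) (α (pieceTop q)) := by
  obtain ⟨u, hu, h1, h2⟩ := hc.exists_climb_att hp hT hf
  obtain ⟨q, hq, rfl⟩ := exists_pieceEdge_of_opens hG hT hg hr hc hp hu h2
    (hT.climb_of_climb_subset (hc.subset_nodes e) h1 hcl)
  exact ⟨q, hq, h1⟩

/-- A component whose root is the first node of an edge is a tree-graph. -/
theorem isTreeGraph_piece (ho : t.Opens F (α r)) : (piece hG hT g hg r hr).IsTreeGraph := by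
  have hext := map_ext_piece (hG := hG) (hT := hT) (hg := hg) (hr := hr)
  obtain ⟨r', ps, hrp⟩ : ∃ r' ps, (piece hG hT g hg r hr).ext = r' :: ps := by
    cases h : (piece hG hT g hg r hr).ext with
    | nil => rw [h] at hext; exact absurd hext (List.cons_ne_nil _ _).symm
    | cons a b => exact ⟨a, b, rfl⟩
  rw [hrp, List.map_cons, List.cons.injEq] at hext
  obtain ⟨hr', hps⟩ := hext
  have hps' : ∀ v, v ∈ ps ↔ pieceNode v ∈ g.ext ∧ t.Hangs F I (α r) (α (pieceNode v)) := by
    intro v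
    rw [← List.mem_map_of_injective pieceNode_injective, hps, mem_leaves,
      hc.hangsBelow_iff hG hp]
  have hlt : ∀ q v, v ∈ ((piece hG hT g hg r hr).att q).tail →
      depth (α (pieceNode ((piece hG hT g hg r hr).top q))) < depth (α (pieceNode v)) := by
    intro q v hv
    rw [pieceNode_top]
    exact hT.depth_lt_of_hangs ((mem_tail_piece_iff hc hp q v).1 hv).2
  refine HGraph.IsTreeWith.isTreeGraph (root := r') (params := ps)
    (depth := fun v => depth (α (pieceNode v))) ⟨hrp, ?_, ?_, ?_, ?_, ?_, ?_, hlt⟩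
  · intro v hv
    have : t.Hangs F I (α r) (α (pieceNode v)) := by
      rcases climb_or_hangs_pieceNode hc hp v with h | h
      · refine hp.hangs_of_climb h ?_
        by_contra hn
        exact hv (pieceNode_injective ((hc.inj (h.eq_of_notMem hn)).trans hr'.symm))
      · exact h
    -- the parent edge of `v` lies in a component of the edge `e` of `g` that generates it
    obtain ⟨f, hf, ht, hcl⟩ := this
    obtain ⟨e, he⟩ := (hc.mem_edges f).1 hf
    obtain ⟨q, rfl, h1⟩ := exists_pieceEdge_of_climb hG hT hg hr hc hp he hcl
    exact ⟨q, (mem_tail_piece_iff hc hp q v).2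
      ⟨hc.mem_att_of_mem hp he (List.mem_of_mem_tail ht), f, he, ht, h1⟩⟩
  · intro v q q' h h'
    obtain ⟨-, f, hf, ht, h1⟩ := (mem_tail_piece_iff hc hp q v).1 h
    obtain ⟨-, f', hf', ht', h1'⟩ := (mem_tail_piece_iff hc hp q' v).1 h'
    obtain rfl := hT.parent_unique _ _ _ ht ht'
    have he := hc.edges_disj _ _ _ hf hf'
    refine pieceEdge_ext he (hc.inj (hT.climb_unique h1 ?_))
    rwa [he]
  · intro q h
    have h1 := hlt q r' h
    rw [pieceNode_top, hr'] at h1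
    exact absurd (hT.depth_le_of_climb (climb_pieceTop hc hp q)) (not_le.2 h1)
  · intro v hv
    have hcl : t.Climb I (α (pieceNode v)) (α r) := by
      rcases climb_or_hangs_pieceNode hc hp v with h | h
      · exact h
      · refine h.climb ?_
        rw [hc.map_mem_iff]
        exact fun hx => hv ((hps' v).2 ⟨hx, h⟩)
    have hop : t.Opens F (α (pieceNode v)) := by
      by_cases hI : α (pieceNode v) ∈ I
      · -- an internal node keeps all its edges, and it is no parameter of `t`
        have hx := hp.notMem_ext _ hI
        rw [hT.ext_eq] at hx
        obtain ⟨f, hf⟩ := hT.exists_top (α (pieceNode v)) fun h => hx (List.mem_cons_of_mem _ h)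
        exact ⟨f, hp.mem_edges _ hI f (hf ▸ t.top_mem_att f), hf⟩
      · rwa [hcl.eq_of_notMem hI]
    obtain ⟨f, hf, hfv⟩ := hop
    obtain ⟨e, he⟩ := (hc.mem_edges f).1 hf
    obtain ⟨q, -, hq⟩ := exists_pieceEdge_of_opens hG hT hg hr hc hp
      (hc.mem_att_of_mem hp he (hfv ▸ t.top_mem_att f)) ⟨f, he, hfv⟩ hcl
    exact ⟨q, pieceNode_injective ((pieceNode_top q).trans hq)⟩
  · intro q q' h
    have h' := congrArg pieceNode h
    rw [pieceNode_top, pieceNode_top] at h'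
    obtain ⟨f, hf, hfv⟩ := opens_pieceTop hc hp q
    obtain ⟨f', hf', hfv'⟩ := opens_pieceTop hc hp q'
    have : f = f' := hT.top_inj _ _ (by rw [hfv, hfv', h'])
    subst this
    exact pieceEdge_ext (hc.edges_disj _ _ _ hf hf') h'
  · intro q h
    obtain ⟨hx, hh⟩ := (hps' _).1 h
    rw [pieceNode_top] at hx hh
    have hcl := climb_pieceTop hc hp q
    rw [hcl.eq_of_notMem (by rw [hc.map_mem_iff]; exact not_not.2 hx)] at hh
    exact (hT.depth_lt_of_hangs hh).ne rfl

end Cover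

end Piece

end HRGrammar

/-! ### The grammar of components -/

namespace HRGrammar

variable {T : Type u} {rk : T → ℕ} {G : HRGrammar rk} {t : HGraph rk} {F : Set t.E}
  {I : Set t.V} {l : List t.V} {root : t.V} {params : List t.V} {depth : t.V → ℕ}

/-- The rule of a nonterminal of a straight-line grammar. -/
noncomputable def IsStraightLine.rule (hG : G.IsStraightLine) (A : G.N) : G.P :=
  (hG.existsUnique_rule A).choose

theorem IsStraightLine.lhs_rule (hG : G.IsStraightLine) (A : G.N) : G.lhs (hG.rule A) = A :=
  (hG.existsUnique_rule A).choose_spec.1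

theorem IsStraightLine.length_ext_rule (hG : G.IsStraightLine) (A : G.N) :
    (G.rhs (hG.rule A)).ext.length = G.nrk A :=
  (G.rank_rhs _).trans (congrArg G.nrk (hG.lhs_rule A))

/-- The positions of the leaves of a component of a right-hand side are the links of its left-hand
side. -/
theorem Cover.leaves_eq (hG : G.IsStraightLine) {p : G.P} {α Fe Ie}
    (hc : G.Cover t (G.rhs p) α Fe Ie F I l) (hp : t.IsPart F I l) {j : ℕ} {r : (G.rhs p).V}
    (hr : (G.rhs p).ext[j]? = some r) :
    G.leaves t (G.rhs p) r = (G.rhs p).ext.pick (G.Link t (Sum.inr (G.lhs p)) j) := by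
  classical
  rw [leaves]
  refine (List.pick_eq_filter fun k v hv => ?_).symm
  rw [hc.hangsBelow_iff hG hp, hc.occ_rule.link_iff hG hp (hc.getElem? hr) (hc.getElem? hv)]

/-- The external node of the right-hand side that is the root of a component. -/
noncomputable def componentRoot (hG : G.IsStraightLine) (q : G.Component t) :
    (G.rhs (hG.rule q.1.1)).V :=
  (G.rhs (hG.rule q.1.1)).ext[q.1.2.1]'(by rw [hG.length_ext_rule]; exact q.1.2.2)

theorem getElem?_componentRoot (hG : G.IsStraightLine) (q : G.Component t) :
    (G.rhs (hG.rule q.1.1)).ext[q.1.2.1]? = some (componentRoot hG q) :=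
  List.getElem?_eq_getElem _

theorem componentRoot_mem (hG : G.IsStraightLine) (q : G.Component t) :
    componentRoot hG q ∈ (G.rhs (hG.rule q.1.1)).ext := List.getElem_mem _

/-- The grammar that generates the components of the hypergraphs generated by the nonterminals of
`G`. -/
noncomputable def treeGrammar (hG : G.IsStraightLine) (hT : t.IsTreeWith root params depth)
    (hpl : ∀ p, G.Placed t (G.rhs p)) (hs : G.Placed t G.start) (r₀ : G.start.V)
    (hr₀ : r₀ ∈ G.start.ext) : HRGrammar rk where
  N := G.Component t
  fintypeN := Fintype.ofFinite _
  nrk := G.componentRank t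
  P := G.Component t
  fintypeP := Fintype.ofFinite _
  lhs := id
  rhs q := piece hG hT (G.rhs (hG.rule q.1.1)) (hpl _) (componentRoot hG q) (componentRoot_mem hG q)
  rank_rhs q := by
    obtain ⟨α, Fe, Ie, F, I, l, hc, hp⟩ := hpl (hG.rule q.1.1)
    have h := congrArg List.length (map_ext_piece (hG := hG) (hT := hT) (hg := hpl _)
      (hr := componentRoot_mem hG q))
    rw [List.length_map, List.length_cons,
      hc.leaves_eq hG hp (getElem?_componentRoot hG q)] at h
    refine h.trans ?_
    rw [hG.lhs_rule, List.length_pick_congr (l' := List.range (G.nrk q.1.1)) _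
      (by rw [hG.length_ext_rule, List.length_range])]
    rfl
  start := piece hG hT G.start hs r₀ hr₀

section TreeGrammar

variable {hG : G.IsStraightLine} {hT : t.IsTreeWith root params depth}
  {hpl : ∀ p, G.Placed t (G.rhs p)} {hs : G.Placed t G.start} {r₀ : G.start.V}
  {hr₀ : r₀ ∈ G.start.ext}

variable (hG hT hpl hs r₀ hr₀) in
/-- The components of a part that is generated by `x` are generated by the tree grammar. -/
def ComponentsOcc (x : T ⊕ G.N) (F : Set t.E) (I : Set t.V) (l : List t.V) : Prop :=
  ∀ (j : ℕ) (w : t.V) (hj : j < Sum.elim rk G.nrk x) (ho : G.Opening t x j), l[j]? = some w →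
    (treeGrammar hG hT hpl hs r₀ hr₀).Occ t (componentLabel x j hj ho)
      {f | f ∈ F ∧ t.Climb I (t.top f) w} {v | v ∈ I ∧ t.Climb I v w}
      (w :: l.pick (G.Link t x j))

/-- If the tree grammar generates the components of the parts generated by the edges of `g`, then
a component of `g` generates the corresponding component of the part generated by `g`. -/
theorem Cover.cover_piece {g : G.Graph} {hg : G.Placed t g} {r : g.V} {hr : r ∈ g.ext} {α Fe Ie}
    (hc : G.Cover t g α Fe Ie F I l) (hp : t.IsPart F I l)
    (ih : ∀ e, ComponentsOcc hG hT hpl hs r₀ hr₀ (g.lab e) (Fe e) (Ie e) ((g.att e).map α)) :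
    ∃ α' Fe' Ie', (treeGrammar hG hT hpl hs r₀ hr₀).Cover t (piece hG hT g hg r hr) α' Fe' Ie'
      {f | f ∈ F ∧ t.Climb I (t.top f) (α r)} {v | v ∈ I ∧ t.Climb I v (α r)}
      (α r :: (G.leaves t g r).map α) := by
  refine ⟨fun v => α (pieceNode v),
    fun q => {f | f ∈ Fe (pieceEdge q) ∧ t.Climb (Ie (pieceEdge q)) (t.top f) (α (pieceTop q))},
    fun q => {v | v ∈ Ie (pieceEdge q) ∧ t.Climb (Ie (pieceEdge q)) v (α (pieceTop q))},
    ⟨⟨?_, ?_, ?_, ?_, ?_, ?_, ?_⟩, ?_⟩⟩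
  · exact hc.inj.comp pieceNode_injective
  · intro f
    constructor
    · rintro ⟨hf, hcl⟩
      obtain ⟨e, he⟩ := (hc.mem_edges f).1 hf
      obtain ⟨q, rfl, h1⟩ := exists_pieceEdge_of_climb hG hT hg hr hc hp he hcl
      exact ⟨q, he, h1⟩
    · rintro ⟨q, hf, hcl⟩
      exact ⟨hc.subset_edges _ hf, hcl.trans (hc.subset_nodes _) (climb_pieceTop hc hp q)⟩
  · intro v
    constructor
    · rintro ⟨hv, hcl⟩
      rcases (hc.mem_nodes v).1 hv with ⟨u, hu, rfl⟩ | ⟨e, he⟩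
      · refine Or.inl ⟨⟨u, Or.inl ((hc.climbs_iff hG hp).2 hcl)⟩, fun h => hu ?_, rfl⟩
        have := List.mem_map_of_mem (f := pieceNode) h
        rw [map_ext_piece, List.mem_cons, mem_leaves] at this
        rcases this with h | h
        · have h' : u = r := h
          rwa [h']
        · exact h.1
      · -- the parent edge of a fresh node of `e` lies in `Fe e`
        have hpe := hc.isPart hp e
        obtain ⟨f, hf, ht, hcl'⟩ := hp.hangs_of_climb hcl hv
        have hfe := hpe.mem_edges v he f (List.mem_of_mem_tail ht)
        obtain ⟨q, rfl, h1⟩ := exists_pieceEdge_of_climb hG hT hg hr hc hp hfe hcl'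
        exact Or.inr ⟨q, he, .up he ht h1⟩
    · rintro (⟨u, hu, rfl⟩ | ⟨q, hv, hcl⟩)
      · have hx : pieceNode u ∉ r :: G.leaves t g r := by
          rw [← map_ext_piece (hG := hG) (hT := hT) (hg := hg) (hr := hr),
            List.mem_map_of_injective pieceNode_injective]
          exact hu
        rw [List.mem_cons, mem_leaves, not_or, not_and, hc.hangsBelow_iff hG hp] at hx
        have hI : α (pieceNode u) ∈ I := by
          rcases climb_or_hangs_pieceNode hc hp u with h | h
          · by_contra hn
            exact hx.1 (hc.inj (h.eq_of_notMem hn))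
          · rw [hc.map_mem_iff]
            exact fun hm => hx.2 hm h
        refine ⟨hI, ?_⟩
        rcases climb_or_hangs_pieceNode hc hp u with h | h
        · exact h
        · exact h.climb hI
      · exact ⟨hc.subset_nodes _ hv, hcl.trans (hc.subset_nodes _) (climb_pieceTop hc hp q)⟩
  · show α r :: (G.leaves t g r).map α = (piece hG hT g hg r hr).ext.map (α ∘ pieceNode)
    rw [← List.map_map, map_ext_piece, List.map_cons]
  · rintro q q' f ⟨h1, h2⟩ ⟨h1', h2'⟩
    have he := hc.edges_disj _ _ f h1 h1'
    rw [← he] at h2'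
    exact pieceEdge_ext he (hc.inj (hT.climb_unique h2 h2'))
  · rintro q q' f ⟨h1, h2⟩ ⟨h1', h2'⟩
    have he := hc.nodes_disj _ _ f h1 h1'
    rw [← he] at h2'
    exact pieceEdge_ext he (hc.inj (hT.climb_unique h2 h2'))
  · rintro q u ⟨h, -⟩
    exact hc.map_notMem _ _ h
  · intro q
    have := ih (pieceEdge q) (piecePos q) (α (pieceTop q)) (piecePos_lt q) (opening_piece q)
      (by rw [List.getElem?_map, getElem?_piecePos]; rfl)
    rw [List.pick_map, ← List.map_cons, ← map_att_piece, List.map_map] at this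
    exact this

theorem Occ.componentsOcc {x : T ⊕ G.N} (h : G.Occ t x F I l) (hp : t.IsPart F I l) :
    ComponentsOcc hG hT hpl hs r₀ hr₀ x F I l := by
  induction h with
  | terminal f =>
    intro j w hj ho hw
    obtain ⟨rfl, -⟩ := ho.terminal
    obtain rfl := (getElem?_att_eq_top_iff f hw).2 rfl
    rw [pick_link_terminal hG hp, ← t.att_eq_top_cons]
    have h1 : {f' | f' ∈ ({f} : Set t.E) ∧ t.Climb ∅ (t.top f') (t.top f)} = {f} := by
      ext f'
      simp only [Set.mem_singleton_iff]
      exact ⟨fun h => h.1, by rintro rfl; exact ⟨rfl, .refl (Set.notMem_empty _)⟩⟩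
    have h2 : {v | v ∈ (∅ : Set t.V) ∧ t.Climb ∅ v (t.top f)} = ∅ := by
      ext v
      exact ⟨fun h => h.1, fun h => absurd h (Set.notMem_empty _)⟩
    rw [h1, h2]
    exact .terminal f
  | rule p α Fe Ie F I l hsp ho ih =>
    intro j w hj hop hw
    have hpA : hG.rule (G.lhs p) = p := hG.rule_unique (hG.lhs_rule _)
    have hcov : G.Cover t (G.rhs p) α Fe Ie F I l := ⟨hsp, ho⟩
    obtain ⟨β, Fh, Ih, hc, ih'⟩ : ∃ β Fh Ih,
        G.Cover t (G.rhs (hG.rule (G.lhs p))) β Fh Ih F I l ∧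
        ∀ e, ComponentsOcc hG hT hpl hs r₀ hr₀ ((G.rhs (hG.rule (G.lhs p))).lab e) (Fh e) (Ih e)
          (((G.rhs (hG.rule (G.lhs p))).att e).map β) := by
      rw [hpA]
      exact ⟨α, Fe, Ie, hcov, fun e => ih e (hcov.isPart hp e)⟩
    let q : G.Component t := ⟨⟨G.lhs p, ⟨j, hj⟩⟩, hop⟩
    have hroot := getElem?_componentRoot hG q
    obtain rfl : w = β (componentRoot hG q) := by
      have := hc.getElem? hroot
      rw [show l[q.1.2.1]? = some w from hw] at this
      exact Option.some.inj this
    obtain ⟨α', Fe', Ie', hc'⟩ := hc.cover_piece (hg := hpl _) (hr := componentRoot_mem hG q) hp ih'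
    have hl : (G.leaves t (G.rhs (hG.rule (G.lhs p))) (componentRoot hG q)).map β =
        l.pick (G.Link t (Sum.inr (G.lhs p)) j) := by
      rw [hc.leaves_eq hG hp hroot, ← List.pick_map, ← hc.ext_eq, hG.lhs_rule]
    rw [hl] at hc'
    exact Cover.occ_rule (G := treeGrammar hG hT hpl hs r₀ hr₀) (p := q) hc'

end TreeGrammar

end HRGrammar

/-! ### The size bound -/

namespace HRGrammar

variable {T : Type u} {rk : T → ℕ} {G : HRGrammar rk} {t : HGraph rk} {F : Set t.E}
  {I : Set t.V} {l : List t.V} {root : t.V} {params : List t.V} {depth : t.V → ℕ}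

section Size

variable {hG : G.IsStraightLine} {hT : t.IsTreeWith root params depth}
  {g : G.Graph} {hg : G.Placed t g} {α : g.V → t.V} {Fe : g.E → Set t.E} {Ie : g.E → Set t.V}
  (hc : G.Cover t g α Fe Ie F I l) (hp : t.IsPart F I l)
  {K : Type} [Fintype K] {ρ : K → g.V} (hρ : Function.Injective ρ) (hr : ∀ k, ρ k ∈ g.ext)

include hc hp hρ

/-- A node of `g` lies in at most two components: once as a root or an internal node, and once as a
leaf. -/
theorem sum_card_piece_le :
    ∑ k, Fintype.card (piece hG hT g hg (ρ k) (hr k)).V ≤ 2 * Fintype.card g.V := by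
  classical
  rw [← Fintype.card_sigma]
  have h2 : 2 * Fintype.card g.V = Fintype.card (g.V × Bool) := by
    rw [Fintype.card_prod, Fintype.card_bool, mul_comm]
  rw [h2]
  refine Fintype.card_le_of_injective
    (fun x => (pieceNode x.2, decide (t.Climb I (α (pieceNode x.2)) (α (ρ x.1))))) ?_
  rintro ⟨k, v⟩ ⟨k', v'⟩ h
  simp only [Prod.mk.injEq, decide_eq_decide] at h
  obtain ⟨hv, hcl⟩ := h
  have hk : k = k' := by
    refine hρ (hc.inj ?_)
    by_cases h : t.Climb I (α (pieceNode v)) (α (ρ k))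
    · have h' := hcl.1 h
      rw [← hv] at h'
      exact hT.climb_unique h h'
    · have h1 := (climb_or_hangs_pieceNode hc hp v).resolve_left h
      have h2 := (climb_or_hangs_pieceNode hc hp v').resolve_left (fun h' => h (hcl.2 h'))
      rw [← hv] at h2
      exact hT.hangs_unique h1 h2
  subst hk
  rw [pieceNode_injective hv]

open Classical in
/-- The components of an edge `e` of rank `n` have at most `n` roots and at most `n` leaves. -/
theorem sum_edgeSize_fiber_le (e : g.E) :
    ∑ x : (Σ k, (piece hG hT g hg (ρ k) (hr k)).E) with pieceEdge x.2 = e,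
      (if ((piece hG hT g hg (ρ x.1) (hr x.1)).att x.2).length ≤ 2 then 1
        else ((piece hG hT g hg (ρ x.1) (hr x.1)).att x.2).length) ≤
      2 * (if (g.att e).length ≤ 2 then 1 else (g.att e).length) := by
  set Φ : Finset (Σ k, (piece hG hT g hg (ρ k) (hr k)).E) :=
    Finset.univ.filter fun x => pieceEdge x.2 = e with hΦ
  have hcard : (g.att e).toFinset.card = (g.att e).length :=
    List.toFinset_card_of_nodup (g.att_nodup e)
  have hinj : ∀ x ∈ Φ, ∀ y ∈ Φ, pieceTop x.2 = pieceTop y.2 → x = y := by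
    rintro ⟨k, q⟩ hx ⟨k', q'⟩ hy h
    simp only [hΦ, Finset.mem_filter, Finset.mem_univ, true_and] at hx hy h
    have h1 := climb_pieceTop hc hp q
    have h2 := climb_pieceTop hc hp q'
    rw [← h] at h2
    obtain rfl := hρ (hc.inj (hT.climb_unique h1 h2))
    rw [pieceEdge_ext (hx.trans hy.symm) h]
  have hΦcard : Φ.card ≤ (g.att e).length := by
    rw [← hcard]
    refine Finset.card_le_card_of_injOn (fun x => pieceTop x.2) (fun x hx => ?_) hinj
    have := (Finset.mem_filter.1 hx).2
    rw [Finset.mem_coe, List.mem_toFinset, ← this]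
    exact pieceTop_mem x.2
  -- the leaves of the component `x` of `e`
  let S : (Σ k, (piece hG hT g hg (ρ k) (hr k)).E) → Finset g.V := fun x =>
    (g.att e).toFinset.filter fun v => t.Hangs (Fe e) (Ie e) (α (pieceTop x.2)) (α v)
  have hlen : ∀ x ∈ Φ, ((piece hG hT g hg (ρ x.1) (hr x.1)).att x.2).length =
      (S x).card + 1 := by
    intro x hx
    have hx' := (Finset.mem_filter.1 hx).2
    rw [← List.length_map (f := pieceNode), map_att_piece, List.length_cons,
      hc.pick_link_eq hG hp (getElem?_piecePos x.2), hx',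
      ← List.toFinset_card_of_nodup ((g.att_nodup e).filter _), List.toFinset_filter]
    simp [S]
  have hS : ∑ x ∈ Φ, (S x).card ≤ (g.att e).length := by
    rw [← Finset.card_biUnion, ← hcard]
    · refine Finset.card_le_card ?_
      rw [Finset.biUnion_subset]
      exact fun x _ => Finset.filter_subset _ _
    · intro x hx y hy hxy
      rw [Function.onFun, Finset.disjoint_left]
      intro v hv hv'
      exact hxy (hinj x hx y hy (hc.inj
        (hT.hangs_unique (Finset.mem_filter.1 hv).2 (Finset.mem_filter.1 hv').2)))
  split_ifs with h
  · have h1 : ∀ x ∈ Φ, ((piece hG hT g hg (ρ x.1) (hr x.1)).att x.2).length ≤ 2 := by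
      intro x hx
      refine le_trans ?_ h
      have hx' := (Finset.mem_filter.1 hx).2
      have hn := ((piece hG hT g hg (ρ x.1) (hr x.1)).att_nodup x.2).map pieceNode_injective
      rw [← List.length_map (f := pieceNode), ← hcard, ← List.toFinset_card_of_nodup hn]
      refine Finset.card_le_card fun v hv => ?_
      rw [List.mem_toFinset, map_att_piece, List.mem_cons,
        hc.mem_pick_link_iff hG hp (getElem?_piecePos x.2), hx'] at hv
      rw [List.mem_toFinset]
      rcases hv with rfl | hv
      · exact hx' ▸ pieceTop_mem x.2
      · exact hv.1
    rw [Finset.sum_congr rfl fun x hx => if_pos (h1 x hx)]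
    simp only [Finset.sum_const, smul_eq_mul, mul_one]
    omega
  · calc _ ≤ ∑ x ∈ Φ, ((S x).card + 1) := by
          refine Finset.sum_le_sum fun x hx => ?_
          rw [hlen x hx]
          split_ifs <;> omega
      _ = ∑ x ∈ Φ, (S x).card + Φ.card := by
          rw [Finset.sum_add_distrib, Finset.sum_const, smul_eq_mul, mul_one]
      _ ≤ _ := by omega

theorem sum_size_piece_le :
    ∑ k, (piece hG hT g hg (ρ k) (hr k)).size ≤ 2 * g.size := by
  classical
  have hE : ∑ k, (piece hG hT g hg (ρ k) (hr k)).edgeSize ≤ 2 * g.edgeSize := by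
    unfold HGraph.edgeSize
    rw [← Fintype.sum_sigma', ← Finset.sum_fiberwise (g := fun x => pieceEdge x.2), Finset.mul_sum]
    exact Finset.sum_le_sum fun e _ => sum_edgeSize_fiber_le hc hp hρ hr e
  have hV := sum_card_piece_le (hG := hG) (hT := hT) (hg := hg) hc hp hρ hr
  simp only [HGraph.size, Finset.sum_add_distrib]
  omega

end Size

end HRGrammar

/-! ### Reachability and the final grammar -/

namespace HRGrammar

variable {T : Type u} {rk : T → ℕ} {G : HRGrammar rk} {t : HGraph rk} {F : Set t.E}
  {I : Set t.V} {l : List t.V} {root : t.V} {params : List t.V} {depth : t.V → ℕ}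

variable (G) in
/-- The nonterminal `A` can be reached from the start graph through right-hand sides. -/
def Reachable (A : G.N) : Prop :=
  ∃ B e, G.start.lab e = Sum.inr B ∧ Relation.ReflTransGen G.Calls B A

theorem reachable_of_derives {g : G.Graph} (h : G.Derives G.start g) {e : g.E} {A : G.N}
    (he : g.lab e = Sum.inr A) : G.Reachable A := by
  unfold Derives at h
  induction h generalizing A with
  | refl => exact ⟨A, e, he, .refl⟩
  | tail _ hs ih =>
    cases hs with
    | mk e₁ p h =>
      rcases e with e | e
      · exact ih (e := e.1) he
      · obtain ⟨B, e₀, hB, hcalls⟩ := ih h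
        exact ⟨B, e₀, hB, hcalls.tail ⟨p, rfl, e, he⟩⟩

theorem Reachable.exists_derives {A : G.N} (h : G.Reachable A) :
    ∃ g, G.Derives G.start g ∧ ∃ e, g.lab e = Sum.inr A := by
  obtain ⟨B, e₀, hB, hcalls⟩ := h
  induction hcalls with
  | refl => exact ⟨G.start, .refl, e₀, hB⟩
  | tail _ hs ih =>
    obtain ⟨g, hg, e, he⟩ := ih
    obtain ⟨p, rfl, e', he'⟩ := hs
    exact ⟨_, hg.tail (Step.mk g e p he), Sum.inr e', he'⟩

/-- Every reachable nonterminal generates a part of `t` if the start graph does. -/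
theorem Placed.exists_occ (hG : G.IsStraightLine) (hs : G.Placed t G.start) {A : G.N}
    (h : G.Reachable A) : ∃ F I l, G.Occ t (Sum.inr A) F I l ∧ t.IsPart F I l := by
  obtain ⟨B, e₀, hB, hcalls⟩ := h
  induction hcalls with
  | refl =>
    obtain ⟨α, Fe, Ie, F, I, l, hc, hp⟩ := hs
    exact ⟨_, _, _, hB ▸ hc.occ e₀, hc.isPart hp e₀⟩
  | tail _ hcall ih =>
    obtain ⟨F, I, l, ho, hp⟩ := ih
    obtain ⟨p, rfl, e, he⟩ := hcall
    obtain ⟨p', hpp, α, Fe, Ie, hc⟩ := ho.exists_cover rfl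
    obtain rfl := hG.rule_unique hpp
    exact ⟨_, _, _, he ▸ hc.occ e, hc.isPart hp e⟩

theorem Placed.rhs (hG : G.IsStraightLine) (hs : G.Placed t G.start) (p : G.P) :
    G.Placed t (G.rhs p) := by
  obtain ⟨g, hg, e, he⟩ := hG.useful (G.lhs p)
  obtain ⟨F, I, l, ho, hp⟩ := hs.exists_occ hG (reachable_of_derives hg he)
  obtain ⟨p', hpp, α, Fe, Ie, hc⟩ := ho.exists_cover rfl
  obtain rfl := hG.rule_unique hpp
  exact ⟨α, Fe, Ie, F, I, l, hc, hp⟩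

theorem componentLabel_eq_inr {x : T ⊕ G.N} {j : ℕ} {hj : j < Sum.elim rk G.nrk x}
    {ho : G.Opening t x j} {q : G.Component t} :
    componentLabel x j hj ho = Sum.inr q ↔ x = Sum.inr q.1.1 ∧ j = q.1.2 := by
  constructor
  · rcases x with a | A
    · intro h
      simp [componentLabel] at h
    · intro h
      have := Sum.inr_injective h
      subst this
      exact ⟨rfl, rfl⟩
  · rintro ⟨rfl, rfl⟩
    rfl

/-- If an edge of `g` is labelled by a nonterminal, then each of its components is an edge of some
component of `g`. -/
theorem Cover.exists_lab_piece (hG : G.IsStraightLine) (hT : t.IsTreeWith root params depth)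
    {g : G.Graph} {α Fe Ie} (hc : G.Cover t g α Fe Ie F I l) (hp : t.IsPart F I l) {e : g.E}
    (q : G.Component t) (he : g.lab e = Sum.inr q.1.1) : ∃ r ∈ g.ext, t.Opens F (α r) ∧
      ∀ hg hr, ∃ q' : (piece hG hT g hg r hr).E, (piece hG hT g hg r hr).lab q' = Sum.inr q := by
  have hlt : q.1.2.1 < (g.att e).length := by
    rw [g.att_rank, he]
    exact q.1.2.2
  have hj := List.getElem?_eq_getElem hlt
  have hop : G.Opening t (g.lab e) q.1.2 := he ▸ q.2
  obtain ⟨f, hf, hfu⟩ := (hc.opening_iff hG hp hj).1 hop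
  have hfF := hc.subset_edges e hf
  obtain ⟨w, hw⟩ := hT.exists_climb (hT.root_notMem hp) (t.top f)
  have hwl := hp.mem_of_climb hw (hp.mem_of_mem_att f hfF _ (t.top_mem_att f))
  rw [hc.ext_eq] at hwl
  obtain ⟨r, hr, rfl⟩ := List.mem_map.1 hwl
  refine ⟨r, hr, hp.opens_of_climb hw ⟨f, hfF, rfl⟩, fun hg hr => ?_⟩
  rw [hfu] at hw
  obtain ⟨q', h1, h2, -⟩ := exists_pieceEdge hG hT hg hr hj hop ((hc.climbs_iff hG hp).2 hw)
  exact ⟨q', componentLabel_eq_inr.2 ⟨(congrArg g.lab h1).trans he, h2⟩⟩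

/-- The root of a component is the first node of an edge. -/
theorem Cover.opens_componentRoot (hG : G.IsStraightLine) (q : G.Component t)
    {α Fe Ie} (hc : G.Cover t (G.rhs (hG.rule q.1.1)) α Fe Ie F I l) (hp : t.IsPart F I l) :
    t.Opens F (α (componentRoot hG q)) := by
  rw [← hc.occ_rule.opening_iff hG hp (hc.getElem? (getElem?_componentRoot hG q)), hG.lhs_rule]
  exact q.2

section TreeGrammar

variable {hG : G.IsStraightLine} {hT : t.IsTreeWith root params depth}
  {hpl : ∀ p, G.Placed t (G.rhs p)} {hs : G.Placed t G.start} {r₀ : G.start.V}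
  {hr₀ : r₀ ∈ G.start.ext}

theorem calls_of_treeGrammar_calls {q q' : G.Component t}
    (h : (treeGrammar hG hT hpl hs r₀ hr₀).Calls q q') : G.Calls q.1.1 q'.1.1 := by
  obtain ⟨p, rfl, e, he⟩ := h
  let e' : (piece hG hT _ (hpl _) (componentRoot hG p) (componentRoot_mem hG p)).E := e
  exact ⟨_, hG.lhs_rule _, pieceEdge e', (componentLabel_eq_inr.1 he).1⟩

theorem treeGrammar_reachable {α Fe Ie}
    (hc : G.Cover t G.start α Fe Ie Set.univ {v | v ∉ t.ext} t.ext) (h₀ : α r₀ = root)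
    (q : G.Component t) : (treeGrammar hG hT hpl hs r₀ hr₀).Reachable q := by
  -- reachability of the nonterminal `q.1.1` in `G` is followed step by step
  obtain ⟨g, hg, e, he⟩ := hG.useful q.1.1
  obtain ⟨B, e₀, hB, hcalls⟩ := reachable_of_derives hg he
  generalize hA : q.1.1 = A at hcalls
  clear hg he
  induction hcalls generalizing q with
  | refl =>
    obtain ⟨r, hr, ⟨f, -, hf⟩, h⟩ :=
      hc.exists_lab_piece hG hT t.isPart_univ q (hB.trans (by rw [hA]))
    have hm : α r ∈ t.ext := by
      rw [hc.ext_eq]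
      exact List.mem_map_of_mem hr
    rw [hT.ext_eq, List.mem_cons] at hm
    have hr' : α r = root := hm.resolve_right (hf ▸ hT.top_notMem_params f)
    obtain rfl := hc.inj (hr'.trans h₀.symm)
    obtain ⟨q', hq'⟩ := h hs hr
    exact ⟨q, q', hq', .refl⟩
  | @tail A' _ _ hcall ih =>
    obtain ⟨p, hpA, e, he⟩ := hcall
    have hpr : p = hG.rule A' := hG.rule_unique (hpA.trans (hG.lhs_rule _).symm)
    subst hpr
    obtain ⟨α, Fe, Ie, F, I, l, hc, hp⟩ := hpl (hG.rule A')
    obtain ⟨r, hr, hop, h⟩ := hc.exists_lab_piece hG hT hp q (he.trans (by rw [hA]))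
    obtain ⟨i, hi⟩ := List.getElem?_of_mem hr
    obtain ⟨hi', hri⟩ := List.getElem?_eq_some_iff.1 hi
    rw [← hc.occ_rule.opening_iff hG hp (hc.getElem? hi), hG.lhs_rule] at hop
    let q₀ : G.Component t := ⟨⟨A', ⟨i, hG.length_ext_rule A' ▸ hi'⟩⟩, hop⟩
    subst hri
    obtain ⟨q', hq'⟩ := h (hpl _) hr
    obtain ⟨B', e', hB', hcalls'⟩ := ih q₀ rfl
    exact ⟨B', e', hB', hcalls'.tail ⟨q₀, rfl, q', hq'⟩⟩

theorem isStraightLine_treeGrammar {α Fe Ie}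
    (hc : G.Cover t G.start α Fe Ie Set.univ {v | v ∉ t.ext} t.ext) (h₀ : α r₀ = root) :
    (treeGrammar hG hT hpl hs r₀ hr₀).IsStraightLine where
  acyclic q h := hG.acyclic q.1.1
    (Relation.TransGen.lift (fun q : G.Component t => q.1.1)
      (fun _ _ => calls_of_treeGrammar_calls) _ _ h)
  existsUnique_rule q := ⟨q, rfl, fun _ h => h⟩
  useful q := (treeGrammar_reachable hc h₀ q).exists_derives

/-- The tree `t` is a single component, so it is generated by the new start graph. -/
theorem cover_treeGrammar_start {α Fe Ie}
    (hc : G.Cover t G.start α Fe Ie Set.univ {v | v ∉ t.ext} t.ext) (h₀ : α r₀ = root) :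
    ∃ α' Fe' Ie', (treeGrammar hG hT hpl hs r₀ hr₀).Cover t
      (treeGrammar hG hT hpl hs r₀ hr₀).start α' Fe' Ie' Set.univ {v | v ∉ t.ext} t.ext := by
  classical
  have hp := t.isPart_univ
  obtain ⟨α', Fe', Ie', h⟩ := hc.cover_piece (hT := hT) (hpl := hpl) (hs := hs) (r₀ := r₀)
    (hr₀ := hr₀) (hg := hs) (hr := hr₀) hp fun e => (hc.occ e).componentsOcc (hc.isPart hp e)
  -- the root of `t` is the only external node that is the first node of an edge
  have hroot : ∀ v w, t.Climb {v | v ∉ t.ext} v w → t.Opens Set.univ w → w = root := by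
    intro v w hcl ⟨f, _, hf⟩
    have hw : w ∈ t.ext := not_not.1 hcl.notMem
    rw [hT.ext_eq, List.mem_cons] at hw
    exact hw.resolve_right (hf ▸ hT.top_notMem_params f)
  have htop : ∀ f, t.Climb {v | v ∉ t.ext} (t.top f) root := by
    intro f
    obtain ⟨w, hw⟩ := hT.exists_climb (hT.root_notMem hp) (t.top f)
    rwa [← hroot _ _ hw (hp.opens_of_climb hw ⟨f, trivial, rfl⟩)]
  have hint : ∀ v, v ∉ t.ext → t.Climb {v | v ∉ t.ext} v root := by
    intro v hv
    obtain ⟨w, hw⟩ := hT.exists_climb (hT.root_notMem hp) v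
    rwa [← hroot _ _ hw (hp.opens_of_hangs (hp.hangs_of_climb hw hv))]
  have hF : {f | f ∈ (Set.univ : Set t.E) ∧ t.Climb {v | v ∉ t.ext} (t.top f) (α r₀)} =
      Set.univ := by
    ext f
    rw [h₀]
    exact ⟨fun _ => trivial, fun _ => ⟨trivial, htop f⟩⟩
  have hI : {v | v ∈ {v | v ∉ t.ext} ∧ t.Climb {v | v ∉ t.ext} v (α r₀)} =
      {v | v ∉ t.ext} := by
    ext v
    rw [h₀]
    exact ⟨fun h => h.1, fun h => ⟨h, hint v h⟩⟩
  have hl : α r₀ :: (G.leaves t G.start r₀).map α = t.ext := by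
    have hext := hc.ext_eq
    rw [hT.ext_eq] at hext
    cases hx : G.start.ext with
    | nil =>
      rw [hx] at hext
      simp at hext
    | cons r rest =>
      rw [hx, List.map_cons, List.cons.injEq] at hext
      obtain rfl := hc.inj (h₀.trans hext.1)
      rw [leaves, hx, List.filter_cons_of_neg, List.filter_eq_self.2, ← hext.2, hT.ext_eq, h₀]
      · intro v hv
        simp only [decide_eq_true_eq]
        rw [hc.hangsBelow_iff hG hp, h₀]
        have hne : α v ≠ root := by
          rw [← h₀]
          intro h
          have hn := G.start.ext_nodup
          rw [hx, List.nodup_cons] at hn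
          exact hn.1 (hc.inj h ▸ hv)
        obtain ⟨f, hf⟩ := hT.exists_parent _ hne
        exact ⟨f, trivial, hf, htop f⟩
      · simp only [decide_eq_true_eq]
        rw [hc.hangsBelow_iff hG hp]
        exact fun h => (hT.depth_lt_of_hangs h).ne rfl
  rw [hF, hI, hl] at h
  exact ⟨α', Fe', Ie', h⟩

theorem size_treeGrammar_le : (treeGrammar hG hT hpl hs r₀ hr₀).size ≤ 2 * G.size := by
  classical
  -- the start graph contributes only one component
  have hstart : (piece hG hT G.start hs r₀ hr₀).size ≤ 2 * G.start.size := by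
    obtain ⟨α, Fe, Ie, F, I, l, hc, hp⟩ := id hs
    have := sum_size_piece_le (hG := hG) (hT := hT) (hg := hs) (K := Unit) (ρ := fun _ => r₀) hc hp
      (fun _ _ _ => rfl) (fun _ => hr₀)
    simpa using this
  have hrule : ∀ A : G.N, ∑ j : {j : Fin (G.nrk A) // G.Opening t (Sum.inr A) j},
      (piece hG hT (G.rhs (hG.rule A)) (hpl _)
        (componentRoot hG (⟨⟨A, j.1⟩, j.2⟩ : G.Component t))
        (componentRoot_mem hG (⟨⟨A, j.1⟩, j.2⟩ : G.Component t))).size ≤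
      2 * (G.rhs (hG.rule A)).size := by
    intro A
    obtain ⟨α, Fe, Ie, F, I, l, hc, hp⟩ := hpl (hG.rule A)
    refine sum_size_piece_le hc hp (fun j j' h => ?_) _
    have h' := (List.Nodup.getElem_inj_iff (G.rhs (hG.rule A)).ext_nodup).1 h
    exact Subtype.ext (Fin.ext h')
  let φ : (Σ A : G.N, {j : Fin (G.nrk A) // G.Opening t (Sum.inr A) j}) ≃
      (treeGrammar hG hT hpl hs r₀ hr₀).P :=
    ⟨fun x => ⟨⟨x.1, x.2.1⟩, x.2.2⟩, fun q => ⟨q.1.1, ⟨q.1.2, q.2⟩⟩, fun _ => rfl, fun _ => rfl⟩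
  have hN : ∑ A, (G.rhs (hG.rule A)).size = ∑ p, (G.rhs p).size :=
    Fintype.sum_bijective hG.rule ⟨fun A B h => by rw [← hG.lhs_rule A, h, hG.lhs_rule],
      fun p => ⟨G.lhs p, hG.rule_unique (hG.lhs_rule _)⟩⟩ _ _ fun _ => rfl
  have hsum : ∑ q, ((treeGrammar hG hT hpl hs r₀ hr₀).rhs q).size ≤ 2 * ∑ p, (G.rhs p).size := by
    rw [← hN, Finset.mul_sum]
    refine le_trans (le_of_eq ?_) (Finset.sum_le_sum fun A _ => hrule A)
    exact (Fintype.sum_equiv φ (fun x => ((treeGrammar hG hT hpl hs r₀ hr₀).rhs (φ x)).size) _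
      fun _ => rfl).symm.trans (Fintype.sum_sigma _)
  have hst : (treeGrammar hG hT hpl hs r₀ hr₀).start.size ≤ 2 * G.start.size := hstart
  simp only [size]
  omega

end TreeGrammar

end HRGrammar

theorem mainTheorem1 {T : Type*} (rk : T → ℕ) (G : HRGrammar rk) (hG : G.IsStraightLine)
    (hval : (G.val hG).IsTreeGraph) :
    ∃ (G' : HRGrammar rk) (hG' : G'.IsStraightLine),
      (G'.val hG').Isomorphic (G.val hG) ∧
      G'.size ≤ 2 * G.size ∧
      G'.start.IsTreeGraph ∧
      ∀ p, (G'.rhs p).IsTreeGraph := by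
  open HRGrammar in
  obtain ⟨root, params, depth, hT⟩ := hval.exists_isTreeWith
  obtain ⟨α, Fe, Ie, hc⟩ := exists_cover_start hG.language_nonempty.some_mem
  have hp := (G.val hG).isPart_univ
  have hs : G.Placed (G.val hG) G.start := ⟨α, Fe, Ie, _, _, _, hc, hp⟩
  have hext : root ∈ G.start.ext.map α := by
    rw [← hc.ext_eq]
    exact hT.ext_eq ▸ List.mem_cons_self
  obtain ⟨r₀, hr₀, h₀⟩ := List.mem_map.1 hext
  have hG' := isStraightLine_treeGrammar (hG := hG) (hT := hT) (hpl := hs.rhs hG) (hs := hs)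
    (hr₀ := hr₀) hc h₀
  refine ⟨_, hG', ?_, size_treeGrammar_le, ?_, fun q => ?_⟩
  · obtain ⟨_, _, _, h₁⟩ := exists_cover_start hG'.language_nonempty.some_mem
    obtain ⟨_, _, _, h₂⟩ := cover_treeGrammar_start (hG := hG) (hT := hT) (hpl := hs.rhs hG)
      (hs := hs) (hr₀ := hr₀) hc h₀
    exact h₁.isomorphic hG' h₂
  · refine isTreeGraph_piece (hG := hG) (hT := hT) (hg := hs) (hr := hr₀) hc hp ?_
    rw [h₀]
    have hn := (G.val hG).ext_nodup
    rw [hT.ext_eq, List.nodup_cons] at hn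
    obtain ⟨f, hf⟩ := hT.exists_top root hn.1
    exact ⟨f, trivial, hf⟩
  · obtain ⟨β, Fh, Ih, F, I, l, hc', hp'⟩ := hs.rhs hG (hG.rule q.1.1)
    exact isTreeGraph_piece (hG := hG) (hT := hT) (hg := hs.rhs hG _)
      (hr := componentRoot_mem hG q) hc' hp' (hc'.opens_componentRoot hG q hp')
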